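/- For each $n$ let $X_1,\dots,X_n$ be i.i.d. standard normal random variables (the null hypothesis). Let $\ell_{\max}=\lceil\log_2(n/8)\rceil$. For $\ell=0,\dots,\ell_{\max}$ set $\epsilon_\ell=\frac{1}{6\sqrt{\log_2(n/2^{\ell-1})}}$, $d_\ell=\lceil\epsilon_\ell 2^{\ell-1}\rceil$, let $$\mathcal I_{app}(\ell)=\{(j,k]\subset(0,n]:\ j,k\in\{i d_\ell: i=0,1,\dots\},\ 2^{\ell-1}<k-j\le 2^\ell\},\qquad n_\ell=\#\mathcal I_{app}(\ell),$$ and let $p_{(1)}\le\dots\le p_{(n_\ell)}$ be the ordered one-sided p-values $\mathbb P\big(N(0,1)\ge \mathbf X(I)\big)$ (with $\mathbf X(I)$ held fixed) of the statistics $\mathbf X(I)=\sum_{i\in I}X_i/\sqrt{|I|}$, $I\in\mathcal I_{app}(\ell)$, where $|I|=k-j$ for $I=(j,k]$. Put $$HC_{n_\ell}(\ell)=\max_{1\le i\le n_\ell/2}\sqrt{n_\ell}\,\frac{i/n_\ell-p_{(i)}}{\sqrt{p_{(i)}(1-p_{(i)})}},$$ $$BJ_{n_\ell}(\ell)=\max_{1\le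 i\le n_\ell/2}\Big(i\log\frac{i}{n_\ell p_{(i)}}+(n_\ell-i)\log\frac{1-i/n_\ell}{1-p_{(i)}}\Big)\mathbf 1\Big(p_{(i)}<\frac{i}{n_\ell}\Big),$$ and define the structured higher criticism and structured Berk-Jones statistics $$sHC_n=\max_{0\le\ell\le\ell_{\max}}\sqrt{\frac{n}{2^\ell n_\ell}}\,HC_{n_\ell}(\ell),\qquad sBJ_n=\max_{0\le\ell\le\ell_{\max}}\frac{n}{2^\ell n_\ell}\,BJ_{n_\ell}(\ell).$$ Then, as $n\to\infty$, (i) $sBJ_n/\log\log n$ is asymptotically at most $3$ in probability, that is, $\mathbb P\big(sBJ_n/\log\log n>3+\epsilon\big)\to0$ for every $\epsilon>0$; (ii) $sHC_n=O_p\big((\log n)^2\big)$, that is, for every $\epsilon>0$ there is a finite $M$ such that $\mathbb P\big(|sHC_n|>M(\log n)^2\big)\le\epsilon$ for all sufficiently large $n$. -/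

import Mathlib

open MeasureTheory ProbabilityTheory Filter Topology

namespace BlockStructure

noncomputable section

/-! ### The approximating set of intervals -/

/-- The largest level `ℓ_max = ⌈log₂ (n / 8)⌉`. -/
def maxLevel (n : ℕ) : ℕ := ⌈Real.logb 2 ((n : ℝ) / 8)⌉₊

/-- The precision `ε_ℓ = 1 / (6 √(log₂ (n / 2 ^ (ℓ - 1))))`. -/
def precision (n l : ℕ) : ℝ :=
  1 / (6 * √(Real.logb 2 ((n : ℝ) / (2 : ℝ) ^ ((l : ℤ) - 1))))

/-- The grid spacing `d_ℓ = ⌈ε_ℓ 2 ^ (ℓ - 1)⌉`. -/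
def gridStep (n l : ℕ) : ℕ := ⌈precision n l * (2 : ℝ) ^ ((l : ℤ) - 1)⌉₊

/-- The set `𝓘_app(ℓ)`. The pair `(j, k)` stands for the interval `(j, k] ⊆ (0, n]`; both endpoints
are multiples of `d_ℓ`, and `2 ^ (ℓ - 1) < k - j ≤ 2 ^ ℓ` (written without subtraction). -/
def approxIntervals (n l : ℕ) : Finset (ℕ × ℕ) :=
  (Finset.range (n + 1) ×ˢ Finset.range (n + 1)).filter fun I =>
    gridStep n l ∣ I.1 ∧ gridStep n l ∣ I.2 ∧
      2 * I.1 + 2 ^ l < 2 * I.2 ∧ I.2 ≤ I.1 + 2 ^ l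

/-! ### Interval statistics and their p-values -/

/-- `𝐗(I) = ∑_{i ∈ I} X_i / √|I|` for `I = (j, k]`; the data are `x 1, …, x n`. -/
def intervalStat (x : ℕ → ℝ) (I : ℕ × ℕ) : ℝ :=
  (∑ i ∈ Finset.Ioc I.1 I.2, x i) / √((I.2 : ℝ) - (I.1 : ℝ))

/-- The one-sided p-value `P (Z ≥ z)` of a `z`-score, with `Z` standard normal. -/
def pValue (z : ℝ) : ℝ := (gaussianReal 0 1).real (Set.Ici z)

/-! ### Higher criticism and Berk-Jones -/

/-- The `i`-th smallest, counted with multiplicity, of the numbers `p a`, `a ∈ s`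
(for `1 ≤ i ≤ #s`): the least `t` such that at least `i` of these numbers are `≤ t`. -/
def orderStat {α : Type*} (s : Finset α) (p : α → ℝ) (i : ℕ) : ℝ :=
  sInf {t : ℝ | i ≤ (s.filter fun a => p a ≤ t).card}

/-- The one-sided higher criticism of the p-values `p a`, `a ∈ s`, the maximum being over
`1 ≤ i ≤ #s / 2`. -/
def higherCriticism {α : Type*} (s : Finset α) (p : α → ℝ) : ℝ :=
  ⨆ i : Finset.Icc 1 (s.card / 2),
    √(s.card : ℝ) * (((i : ℕ) : ℝ) / (s.card : ℝ) - orderStat s p i) /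
      √(orderStat s p i * (1 - orderStat s p i))

/-- The one-sided Berk-Jones statistic of the p-values `p a`, `a ∈ s`, the maximum being over
`1 ≤ i ≤ #s / 2`. -/
def berkJones {α : Type*} (s : Finset α) (p : α → ℝ) : ℝ :=
  ⨆ i : Finset.Icc 1 (s.card / 2),
    if orderStat s p i < ((i : ℕ) : ℝ) / (s.card : ℝ) then
      ((i : ℕ) : ℝ) * Real.log (((i : ℕ) : ℝ) / ((s.card : ℝ) * orderStat s p i)) +
        ((s.card : ℝ) - ((i : ℕ) : ℝ)) *
          Real.log ((1 - ((i : ℕ) : ℝ) / (s.card : ℝ)) / (1 - orderStat s p i))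
    else 0

/-- The structured higher criticism `sHC_n` of the data `x 1, …, x n`. -/
def structuredHC (n : ℕ) (x : ℕ → ℝ) : ℝ :=
  ⨆ l : Finset.range (maxLevel n + 1),
    √((n : ℝ) / ((2 : ℝ) ^ (l : ℕ) * ((approxIntervals n l).card : ℝ))) *
      higherCriticism (approxIntervals n l) fun I => pValue (intervalStat x I)

/-- The structured Berk-Jones statistic `sBJ_n` of the data `x 1, …, x n`. -/
def structuredBJ (n : ℕ) (x : ℕ → ℝ) : ℝ :=
  ⨆ l : Finset.range (maxLevel n + 1),
    (n : ℝ) / ((2 : ℝ) ^ (l : ℕ) * ((approxIntervals n l).card : ℝ)) *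
      berkJones (approxIntervals n l) fun I => pValue (intervalStat x I)

/-! ### Asymptotics in probability (the `n`-th variable lives on its own space) -/

/-- `Y_n` is asymptotically at most `c` in probability:
`P (Y_n > c + ε) → 0` for every `ε > 0`. -/
def AsympLEInProb {Ω : ℕ → Type*} [∀ n, MeasurableSpace (Ω n)] (P : ∀ n, Measure (Ω n))
    (Y : ∀ n, Ω n → ℝ) (c : ℝ) : Prop :=
  ∀ ε : ℝ, 0 < ε → Tendsto (fun n => P n {ω | c + ε < Y n ω}) atTop (𝓝 0)

/-- `Y_n = O_p(a_n)`: for every `ε > 0` there is a finite `M` such that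
`P (|Y_n / a_n| > M) ≤ ε` for all large `n`. -/
def IsBigOInProb {Ω : ℕ → Type*} [∀ n, MeasurableSpace (Ω n)] (P : ∀ n, Measure (Ω n))
    (Y : ∀ n, Ω n → ℝ) (a : ℕ → ℝ) : Prop :=
  ∀ ε : ℝ, 0 < ε → ∃ M : ℝ, ∀ᶠ n in atTop, P n {ω | M < |Y n ω / a n|} ≤ ENNReal.ofReal ε

end

end BlockStructure

/-!
Write `N` for the number of intervals of level `l`, `F` for the empirical distribution function of
their p-values and `v = n / 2 ^ l`. The `i`-th Berk-Jones term is `N * bernKL (i / N) p_(i)`, with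
`bernKL f t` the relative entropy of Bernoulli `f` with respect to Bernoulli `t`, and the weight of
the level is `v / N`. Hence statement (i) follows once
`v * bernKL (i / N) p_(i) ≤ 3 log log n` holds for all `l` and `i` with probability tending to one
(`BernKLBounded`).

*One group of independent observations.* For a threshold `z` give each observation the weight
`tilt ν γ z`: a constant above `1` on `[z, ∞)` and `1 - γ` below, with mean one. Since the value
below `z` does not depend on `z`, the product of these weights is a martingale in `z`, and Ville's
inequality bounds it at all thresholds simultaneously (`meas_exists_prod_tilt_gt_le`); hence
moments of order `q < 1` of its supremum are at most `1 / (1 - q)`. The normalized logarithm of the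
product is `tiltRate γ F t` with `t = ν [z, ∞)`. It is concave in `γ`, vanishes at `γ = 0` and
equals `bernKL F t` at `γ = (F - t) / (1 - t)`, so `γ` need only run through a geometric grid of
`O(log n)` values (`mul_bernKL_le_tiltRate`).

*One level.* The intervals are sorted by their length and by the residue of their left end modulo
(roughly) `2 ^ l`. Intervals with the same label are disjoint, so their statistics are i.i.d.
standard normal. The log-likelihood ratio of the level is the sum over the groups, and convexity of
`exp` turns the moment bound of single groups into
`P (sum > y) ≤ exp (-q y / G) / (1 - q)` for `G` groups, with no loss from the number of groups
(`meas_exists_finset_sum_log_tilt_gt_le`). Counting gives `v * G / N ≤ n / (n - 2 ^ l) ≤ 4 / 3`.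

*All levels.* There are `O(log n)` levels and `O(log n)` grid points, and each of these events has
probability `O((log n) ^ (-3 * (3 / 4) * q * ρ))`. For `q = ρ = 24 / 25` the exponent exceeds `2`
in absolute value, so that the union bound tends to zero.

*Higher criticism.* From `(f - t) ^ 2 / (2 f) ≤ bernKL f t` and the fact that all p-values of level
`l` exceed `1 / (v (log n) ^ 3)`, a union bound using `N = O(v log n)`, one gets
`v (f - t) ^ 2 / (t (1 - t)) ≤ (log n) ^ 4` (`hc_sq_le`), hence the upper bound in (ii). The lower
bound needs only the term `i = 1` of the last level, where `v ≤ 8`.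
-/

namespace BlockStructure

/-! ### Likelihood-ratio martingales of counting processes and Ville's inequality -/

/-- The likelihood ratio of one observation `u`, seen only through whether `z ≤ u`: the
alternative multiplies the mass below `z` by `1 - γ`, the value above `z` being fixed by total mass
one. As the factor `1 - γ` does not depend on `z`, products of these weights form a martingale in
`z`. -/
noncomputable def tilt (ν : Measure ℝ) (γ z u : ℝ) : ℝ :=
  if z ≤ u then 1 + γ * (1 - ν.real (Set.Ici z)) / ν.real (Set.Ici z) else 1 - γ

section Ville

variable {ν : Measure ℝ} [IsProbabilityMeasure ν] {γ : ℝ}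

lemma tilt_pos (h0 : 0 ≤ γ) (h1 : γ < 1) (z u : ℝ) : 0 < tilt ν γ z u := by
  unfold tilt
  split_ifs
  · have h2 : ν.real (Set.Ici z) ≤ 1 := measureReal_le_one
    have : 0 ≤ γ * (1 - ν.real (Set.Ici z)) / ν.real (Set.Ici z) :=
      div_nonneg (mul_nonneg h0 (by linarith)) measureReal_nonneg
    linarith
  · linarith

omit [IsProbabilityMeasure ν] in
lemma measurable_tilt (z : ℝ) : Measurable (tilt ν γ z) :=
  Measurable.ite measurableSet_Ici measurable_const measurable_const

omit [IsProbabilityMeasure ν] in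
lemma tilt_congr {z u v : ℝ} (hu : z ≤ u) (hv : z ≤ v) : tilt ν γ z u = tilt ν γ z v := by
  simp [tilt, hu, hv]

/-- The mass of the alternative on `[z, ∞)` is the same for every threshold `w ≥ z`. -/
lemma setLIntegral_Ici_tilt (h0 : 0 ≤ γ) (h1 : γ < 1) {z w : ℝ} (hzw : z ≤ w)
    (hp : 0 < ν.real (Set.Ici w)) :
    ∫⁻ u in Set.Ici z, ENNReal.ofReal (tilt ν γ w u) ∂ν
      = ENNReal.ofReal (γ + (1 - γ) * ν.real (Set.Ici z)) := by
  have hq : ν.real (Set.Ici w) ≤ 1 := measureReal_le_one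
  have hsplit : Set.Ici z = Set.Ico z w ∪ Set.Ici w := (Set.Ico_union_Ici_eq_Ici hzw).symm
  have hdisj : Disjoint (Set.Ico z w) (Set.Ici w) :=
    Set.disjoint_left.2 fun x hx hx' => not_le.2 hx.2 hx'
  have hadd : ν.real (Set.Ici z) = ν.real (Set.Ico z w) + ν.real (Set.Ici w) := by
    rw [hsplit, measureReal_union hdisj measurableSet_Ici]
  have e1 : ∫⁻ u in Set.Ico z w, ENNReal.ofReal (tilt ν γ w u) ∂ν
      = ENNReal.ofReal ((1 - γ) * ν.real (Set.Ico z w)) := by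
    rw [setLIntegral_congr_fun (g := fun _ => ENNReal.ofReal (1 - γ)) measurableSet_Ico
      (fun u hu => by simp [tilt, not_le.2 hu.2]), setLIntegral_const,
      ENNReal.ofReal_mul (by linarith), ofReal_measureReal]
  have e2 : ∫⁻ u in Set.Ici w, ENNReal.ofReal (tilt ν γ w u) ∂ν
      = ENNReal.ofReal (ν.real (Set.Ici w) + γ * (1 - ν.real (Set.Ici w))) := by
    rw [setLIntegral_congr_fun (g := fun _ => ENNReal.ofReal
      (1 + γ * (1 - ν.real (Set.Ici w)) / ν.real (Set.Ici w))) measurableSet_Ici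
      (fun u hu => by simp [tilt, Set.mem_Ici.1 hu]), setLIntegral_const]
    rw [← ofReal_measureReal (μ := ν) (s := Set.Ici w), ← ENNReal.ofReal_mul]
    · congr 1; field_simp
    · have : 0 ≤ γ * (1 - ν.real (Set.Ici w)) / ν.real (Set.Ici w) :=
        div_nonneg (mul_nonneg h0 (by linarith)) hp.le
      linarith
  rw [hsplit, lintegral_union measurableSet_Ici hdisj, e1, e2, ← ENNReal.ofReal_add, ← hsplit, hadd]
  · congr 1; ring
  · exact mul_nonneg (by linarith) measureReal_nonneg
  · exact add_nonneg hp.le (mul_nonneg h0 (by linarith))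

lemma lintegral_tilt (h0 : 0 ≤ γ) (h1 : γ < 1) {w : ℝ} (hp : 0 < ν.real (Set.Ici w)) :
    ∫⁻ u, ENNReal.ofReal (tilt ν γ w u) ∂ν = 1 := by
  have e1 : ∫⁻ u in (Set.Ici w)ᶜ, ENNReal.ofReal (tilt ν γ w u) ∂ν
      = ENNReal.ofReal ((1 - γ) * ν.real (Set.Ici w)ᶜ) := by
    rw [setLIntegral_congr_fun (g := fun _ => ENNReal.ofReal (1 - γ)) measurableSet_Ici.compl
      (fun u hu => by
        have hu' : ¬ w ≤ u := hu
        simp [tilt, hu']), setLIntegral_const,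
      ENNReal.ofReal_mul (by linarith), ofReal_measureReal]
  rw [← lintegral_add_compl _ (measurableSet_Ici (a := w)), setLIntegral_Ici_tilt h0 h1 le_rfl hp,
    e1, ← ENNReal.ofReal_add, probReal_compl_eq_one_sub measurableSet_Ici]
  · rw [← ENNReal.ofReal_one]; congr 1; ring
  · exact add_nonneg h0 (mul_nonneg (by linarith) hp.le)
  · exact mul_nonneg (by linarith) measureReal_nonneg

variable {ι : Type*} [Fintype ι]

omit [IsProbabilityMeasure ν] in
lemma measurable_prod_tilt (c : ι → ℝ) :
    Measurable fun x : ι → ℝ => ∏ i, ENNReal.ofReal (tilt ν γ (c i) (x i)) :=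
  Finset.measurable_fun_prod _ fun i _ =>
    ((measurable_tilt (c i)).comp (measurable_pi_apply i)).ennreal_ofReal

/-- Raising the threshold of one coordinate from `z` to `w` does not change the integral against a
function that does not distinguish values of a coordinate above `z`. -/
lemma lintegral_prod_tilt_update [DecidableEq ι] (h0 : 0 ≤ γ) (h1 : γ < 1)
    (hp : ∀ z, 0 < ν.real (Set.Ici z)) {G : (ι → ℝ) → ENNReal} (hG : Measurable G) {z w : ℝ}
    (hzw : z ≤ w)
    (hins : ∀ x i u v, z ≤ u → z ≤ v → G (Function.update x i u) = G (Function.update x i v))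
    (c : ι → ℝ) (a : ι) (hc : c a = z) :
    ∫⁻ x, G x * ∏ i, ENNReal.ofReal (tilt ν γ (c i) (x i)) ∂(Measure.pi fun _ => ν)
      = ∫⁻ x, G x * ∏ i, ENNReal.ofReal (tilt ν γ (Function.update c a w i) (x i))
          ∂(Measure.pi fun _ => ν) := by
  refine lintegral_eq_of_lmarginal_eq {a} (hG.mul (measurable_prod_tilt _))
    (hG.mul (measurable_prod_tilt _)) ?_
  rw [lmarginal_singleton, lmarginal_singleton]
  funext x
  have key : ∀ b : ℝ, z ≤ b → ∫⁻ u, G (Function.update x a u) * ENNReal.ofReal (tilt ν γ b u) ∂ν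
      = (∫⁻ u in (Set.Ici z)ᶜ, G (Function.update x a u) * ENNReal.ofReal (1 - γ) ∂ν)
        + G (Function.update x a z) * ENNReal.ofReal (γ + (1 - γ) * ν.real (Set.Ici z)) := by
    intro b hb
    rw [← lintegral_add_compl _ (measurableSet_Ici (a := z)), add_comm]
    congr 1
    · refine setLIntegral_congr_fun measurableSet_Ici.compl fun u hu => ?_
      have : ¬ b ≤ u := fun h => hu (hb.trans h)
      simp [tilt, this]
    · rw [← setLIntegral_Ici_tilt h0 h1 hb (hp b),
        ← lintegral_const_mul _ (measurable_tilt b).ennreal_ofReal]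
      refine setLIntegral_congr_fun measurableSet_Ici fun u hu => ?_
      simp only [hins x a u z hu le_rfl]
  have hrest : ∀ (c' : ι → ℝ), (∀ i ≠ a, c' i = c i) → ∀ u : ℝ,
      G (Function.update x a u) *
        ∏ i, ENNReal.ofReal (tilt ν γ (c' i) (Function.update x a u i))
      = (∏ i ∈ Finset.univ.erase a, ENNReal.ofReal (tilt ν γ (c i) (x i))) *
        (G (Function.update x a u) * ENNReal.ofReal (tilt ν γ (c' a) u)) := by
    intro c' hc' u
    rw [← Finset.mul_prod_erase _ _ (Finset.mem_univ a), Function.update_self,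
      Finset.prod_congr rfl (g := fun i => ENNReal.ofReal (tilt ν γ (c i) (x i)))]
    · ring
    · intro i hi
      have hia := Finset.ne_of_mem_erase hi
      rw [Function.update_of_ne hia, hc' i hia]
  have hmeas : ∀ b, Measurable fun u =>
      G (Function.update x a u) * ENNReal.ofReal (tilt ν γ b u) := fun b =>
    (hG.comp (measurable_update x)).mul (measurable_tilt b).ennreal_ofReal
  simp_rw [hrest c fun _ _ => rfl,
    hrest (Function.update c a w) fun i hi => Function.update_of_ne hi _ _]
  rw [lintegral_const_mul _ (hmeas _), lintegral_const_mul _ (hmeas _), Function.update_self, hc,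
    key z le_rfl, key w hzw]

/-- The martingale property of the likelihood ratio in the threshold, on an event determined by the
information available at threshold `z`. -/
lemma lintegral_prod_tilt_eq [DecidableEq ι] (h0 : 0 ≤ γ) (h1 : γ < 1)
    (hp : ∀ z, 0 < ν.real (Set.Ici z)) {B : Set (ι → ℝ)} (hB : MeasurableSet B) {z w : ℝ}
    (hzw : z ≤ w)
    (hins : ∀ x i u v, z ≤ u → z ≤ v →
      (Function.update x i u ∈ B ↔ Function.update x i v ∈ B)) :
    ∫⁻ x in B, ∏ i, ENNReal.ofReal (tilt ν γ z (x i)) ∂(Measure.pi fun _ => ν)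
      = ∫⁻ x in B, ∏ i, ENNReal.ofReal (tilt ν γ w (x i)) ∂(Measure.pi fun _ => ν) := by
  have hind : ∀ c : ι → ℝ,
      ∫⁻ x in B, ∏ i, ENNReal.ofReal (tilt ν γ (c i) (x i)) ∂(Measure.pi fun _ => ν)
      = ∫⁻ x, B.indicator 1 x * ∏ i, ENNReal.ofReal (tilt ν γ (c i) (x i))
          ∂(Measure.pi fun _ => ν) := by
    intro c
    rw [← lintegral_indicator hB]
    refine lintegral_congr fun x => ?_
    by_cases hx : x ∈ B <;> simp [hx]
  have main : ∀ s : Finset ι,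
      ∫⁻ x in B, ∏ i, ENNReal.ofReal (tilt ν γ z (x i)) ∂(Measure.pi fun _ => ν)
      = ∫⁻ x in B, ∏ i, ENNReal.ofReal (tilt ν γ (if i ∈ s then w else z) (x i))
          ∂(Measure.pi fun _ => ν) := by
    intro s
    induction s using Finset.induction_on with
    | empty => simp
    | insert a s ha ih =>
      have hu' : ∀ i, (if i ∈ insert a s then w else z)
          = Function.update (fun i => if i ∈ s then w else z) a w i := by
        intro i
        by_cases hi : i = a
        · subst hi; simp
        · simp [hi]
      rw [ih, hind fun i => if i ∈ s then w else z, hind fun i => if i ∈ insert a s then w else z]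
      refine (lintegral_prod_tilt_update h0 h1 hp (measurable_one.indicator hB) hzw ?_ _ a
        (by simp [ha])).trans (lintegral_congr fun x => ?_)
      swap
      · refine congrArg _ (Finset.prod_congr rfl fun i _ => ?_)
        rw [hu' i]
      intro x i u v hu hv
      by_cases h : Function.update x i u ∈ B
      · rw [Set.indicator_of_mem h, Set.indicator_of_mem ((hins x i u v hu hv).1 h)]
        rfl
      · rw [Set.indicator_of_notMem h, Set.indicator_of_notMem (mt (hins x i u v hu hv).2 h)]
  simpa using main Finset.univ

/-- Ville's inequality for the likelihood ratio of i.i.d. observations, at finitely many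
thresholds. -/
lemma meas_exists_prod_tilt_gt_le (h0 : 0 ≤ γ) (h1 : γ < 1)
    (hp : ∀ z, 0 < ν.real (Set.Ici z)) (T : Finset ℝ) {a : ℝ} (ha : 0 < a) :
    Measure.pi (fun _ : ι => ν) {x | ∃ z ∈ T, a < ∏ i, tilt ν γ z (x i)}
      ≤ ENNReal.ofReal (1 / a) := by
  classical
  set μ := Measure.pi (fun _ : ι => ν)
  let B : Finset ℝ → Set (ι → ℝ) := fun T => {x | ∃ z ∈ T, a < ∏ i, tilt ν γ z (x i)}
  have hM : ∀ z, MeasurableSet {x : ι → ℝ | a < ∏ i, tilt ν γ z (x i)} := fun z =>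
    measurableSet_lt measurable_const (Finset.measurable_fun_prod _ fun i _ =>
      (measurable_tilt z).comp (measurable_pi_apply i))
  have hBm : ∀ T, MeasurableSet (B T) := fun T => by
    have : B T = ⋃ z ∈ T, {x : ι → ℝ | a < ∏ i, tilt ν γ z (x i)} := by
      ext x; simp [B]
    rw [this]
    exact Finset.measurableSet_biUnion _ fun z _ => hM z
  have hprod : ∀ z (x : ι → ℝ), ∏ i, ENNReal.ofReal (tilt ν γ z (x i))
      = ENNReal.ofReal (∏ i, tilt ν γ z (x i)) := fun z x =>
    (ENNReal.ofReal_prod_of_nonneg fun i _ => (tilt_pos h0 h1 _ _).le).symm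
  -- induction on the largest threshold: the event is split according to whether `z` is the first
  -- threshold at which the level `a` is exceeded
  have claim : ∀ T : Finset ℝ, ∀ w, (∀ z ∈ T, z ≤ w) →
      ENNReal.ofReal a * μ (B T) ≤ ∫⁻ x in B T, ∏ i, ENNReal.ofReal (tilt ν γ w (x i)) ∂μ := by
    intro T
    induction T using Finset.induction_on_max with
    | empty => intro w _; simp [B]
    | insert z T hz ih =>
      intro w hw
      have hzw : z ≤ w := hw z (Finset.mem_insert_self _ _)
      have hins : ∀ x i u v, z ≤ u → z ≤ v →
          (Function.update x i u ∈ B (insert z T) ↔ Function.update x i v ∈ B (insert z T)) := by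
        intro x i u v hu hv
        have : ∀ z' ∈ insert z T, ∏ j, tilt ν γ z' (Function.update x i u j)
            = ∏ j, tilt ν γ z' (Function.update x i v j) := by
          intro z' hz'
          have hz'z : z' ≤ z := by
            rcases Finset.mem_insert.1 hz' with h | h
            · exact h.le
            · exact (hz z' h).le
          refine Finset.prod_congr rfl fun j _ => ?_
          by_cases hj : j = i
          · subst hj
            simp only [Function.update_self]
            exact tilt_congr (hz'z.trans hu) (hz'z.trans hv)
          · simp only [Function.update_of_ne hj]
        simp only [B, Set.mem_ofPred_eq]
        exact exists_congr fun z' => and_congr_right fun hz' => by rw [this z' hz']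
      rw [← lintegral_prod_tilt_eq h0 h1 hp (hBm _) hzw hins]
      have hU : B (insert z T) = B T ∪ ({x | a < ∏ i, tilt ν γ z (x i)} \ B T) := by
        rw [Set.union_sdiff_self]
        ext x; simp [B, or_comm]
      have hm2 := (hM z).diff (hBm T)
      rw [hU, lintegral_union hm2 Set.disjoint_sdiff_right,
        measure_union Set.disjoint_sdiff_right hm2, mul_add]
      refine add_le_add (ih z fun z' h => (hz z' h).le) ?_
      rw [← setLIntegral_const]
      refine setLIntegral_mono (measurable_prod_tilt _) fun x hx => ?_
      rw [hprod]
      exact ENNReal.ofReal_le_ofReal (le_of_lt hx.1)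
  rcases T.eq_empty_or_nonempty with rfl | hT
  · simp
  have h2 := claim T (T.max' hT) fun z hz => T.le_max' z hz
  have h3 : ∫⁻ x in B T, ∏ i, ENNReal.ofReal (tilt ν γ (T.max' hT) (x i)) ∂μ ≤ 1 := by
    refine (setLIntegral_le_lintegral _ _).trans ?_
    have hm : Measurable fun u => ENNReal.ofReal (tilt ν γ (T.max' hT) u) :=
      (measurable_tilt _).ennreal_ofReal
    have hind := iIndepFun_pi (μ := fun _ : ι => ν)
      (X := fun _ u => ENNReal.ofReal (tilt ν γ (T.max' hT) u)) fun _ => hm.aemeasurable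
    rw [lintegral_prod_eq_prod_lintegral_of_indepFun Finset.univ _ hind
      fun i => hm.comp (measurable_pi_apply i)]
    refine Finset.prod_le_one' fun i _ => le_of_eq ?_
    rw [(measurePreserving_eval (fun _ : ι => ν) i).lintegral_comp hm, lintegral_tilt h0 h1 (hp _)]
  have h4 := h2.trans h3
  rw [one_div, ENNReal.ofReal_inv_of_pos ha]
  rw [mul_comm] at h4
  rwa [← ENNReal.le_div_iff_mul_le (by simp [ha]) (by simp), one_div] at h4

end Ville

/-! ### Moments of the running maximum and averaging over independent groups -/

/-- A random variable with the weak-type bound `P (f > a) ≤ 1 / a` has all moments of order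
`q < 1`. -/
lemma lintegral_rpow_le_of_tail {Ω : Type*} [MeasurableSpace Ω] {μ : Measure Ω}
    [IsProbabilityMeasure μ] {f : Ω → ℝ} (hf : ∀ ω, 0 ≤ f ω) (hm : Measurable f)
    (htail : ∀ a, 0 < a → μ {ω | a < f ω} ≤ ENNReal.ofReal (1 / a)) {q : ℝ} (h0 : 0 < q)
    (h1 : q < 1) :
    ∫⁻ ω, ENNReal.ofReal (f ω ^ q) ∂μ ≤ ENNReal.ofReal (1 / (1 - q)) := by
  rw [lintegral_rpow_eq_lintegral_meas_lt_mul μ (ae_of_all _ hf) hm.aemeasurable h0]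
  have hsplit : Set.Ioi (0 : ℝ) = Set.Ioc 0 1 ∪ Set.Ioi 1 :=
    (Set.Ioc_union_Ioi_eq_Ioi zero_le_one).symm
  have e1 : ∫⁻ t in Set.Ioc (0 : ℝ) 1, μ {a | t < f a} * ENNReal.ofReal (t ^ (q - 1))
      ≤ ENNReal.ofReal (1 / q) := by
    have hint : IntegrableOn (fun t : ℝ => t ^ (q - 1)) (Set.Ioc 0 1) :=
      (intervalIntegrable_iff_integrableOn_Ioc_of_le zero_le_one).1
        (intervalIntegral.intervalIntegrable_rpow' (by linarith))
    have hval : ∫ t in Set.Ioc (0 : ℝ) 1, t ^ (q - 1) = 1 / q := by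
      rw [← intervalIntegral.integral_of_le zero_le_one, integral_rpow (Or.inl (by linarith))]
      simp [Real.zero_rpow h0.ne']
    rw [← hval, ofReal_integral_eq_lintegral_ofReal hint]
    · refine lintegral_mono fun t => ?_
      calc μ {a | t < f a} * ENNReal.ofReal (t ^ (q - 1))
          ≤ 1 * ENNReal.ofReal (t ^ (q - 1)) := by gcongr; exact prob_le_one
        _ = _ := one_mul _
    · filter_upwards [ae_restrict_mem measurableSet_Ioc] with t ht
      exact Real.rpow_nonneg ht.1.le _
  have e2 : ∫⁻ t in Set.Ioi (1 : ℝ), μ {a | t < f a} * ENNReal.ofReal (t ^ (q - 1))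
      ≤ ENNReal.ofReal (1 / (1 - q)) := by
    have hval : ∫ t in Set.Ioi (1 : ℝ), t ^ (q - 2) = 1 / (1 - q) := by
      rw [integral_Ioi_rpow_of_lt (by linarith) one_pos, Real.one_rpow, ← neg_div_neg_eq]
      congr 1 <;> ring
    rw [← hval, ofReal_integral_eq_lintegral_ofReal
      (integrableOn_Ioi_rpow_of_lt (by linarith) one_pos)]
    · refine setLIntegral_mono' measurableSet_Ioi fun t ht => ?_
      have ht0 : 0 < t := one_pos.trans ht
      calc μ {a | t < f a} * ENNReal.ofReal (t ^ (q - 1))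
          ≤ ENNReal.ofReal (1 / t) * ENNReal.ofReal (t ^ (q - 1)) := by gcongr; exact htail t ht0
        _ = _ := by
          rw [← ENNReal.ofReal_mul (by positivity)]
          congr 1
          rw [show q - 2 = (q - 1) - 1 by ring, Real.rpow_sub_one ht0.ne' (q - 1)]
          ring
    · filter_upwards [ae_restrict_mem measurableSet_Ioi] with t ht
      exact Real.rpow_nonneg (zero_le_one.trans (le_of_lt ht)) _
  have hdisj : Disjoint (Set.Ioc (0 : ℝ) 1) (Set.Ioi 1) :=
    Set.disjoint_left.2 fun x hx hx' => not_lt.2 hx.2 hx'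
  have h1q : 0 < 1 - q := by linarith
  rw [hsplit, lintegral_union measurableSet_Ioi hdisj]
  calc _ ≤ ENNReal.ofReal q * (ENNReal.ofReal (1 / q) + ENNReal.ofReal (1 / (1 - q))) := by gcongr
    _ = ENNReal.ofReal (1 / (1 - q)) := by
      rw [← ENNReal.ofReal_add (by positivity) (by positivity), ← ENNReal.ofReal_mul h0.le]
      congr 1
      field_simp
      ring

section Groups

variable {ν : Measure ℝ} [IsProbabilityMeasure ν] {γ : ℝ} {Ω : Type*} [MeasurableSpace Ω]
  {P : Measure Ω} {α β : Type*} [DecidableEq β]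

/-- The log-likelihood ratio of possibly dependent observations `Y a` that split into groups (the
fibres of `label`) of i.i.d. observations with law `ν`: at the level `y`, only the average `y / #Λ`
per group enters the bound. -/
lemma meas_exists_finset_sum_log_tilt_gt_le (h0 : 0 ≤ γ) (h1 : γ < 1)
    (hp : ∀ z, 0 < ν.real (Set.Ici z)) {s : Finset α} {label : α → β} {Λ : Finset β}
    (hmaps : ∀ a ∈ s, label a ∈ Λ) (hΛ : Λ.Nonempty) {Y : α → Ω → ℝ}
    (hlaw : ∀ g ∈ Λ, HasLaw (fun ω (a : {a // a ∈ s.filter fun a => label a = g}) => Y a ω)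
      (Measure.pi fun _ => ν) P)
    {q : ℝ} (hq0 : 0 < q) (hq1 : q < 1) (y : ℝ) (T : Finset ℝ) :
    P {ω | ∃ z ∈ T, y < ∑ a ∈ s, Real.log (tilt ν γ z (Y a ω))}
      ≤ ENNReal.ofReal (1 / (1 - q) * Real.exp (-(q * y / Λ.card))) := by
  classical
  rcases T.eq_empty_or_nonempty with rfl | hT
  · simp
  let S : ∀ g : β, ({a // a ∈ s.filter fun a => label a = g} → ℝ) → ℝ := fun g x =>
    T.sup' hT fun z => ∏ a, tilt ν γ z (x a)
  have hprodm : ∀ g z, Measurable fun x : {a // a ∈ s.filter fun a => label a = g} → ℝ =>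
      ∏ a, tilt ν γ z (x a) := fun g z =>
    Finset.measurable_fun_prod _ fun a _ => (measurable_tilt z).comp (measurable_pi_apply a)
  have hSm : ∀ g, Measurable (S g) := fun g => by
    have := Finset.measurable_sup' hT (f := fun z
      (x : {a // a ∈ s.filter fun a => label a = g} → ℝ) => ∏ a, tilt ν γ z (x a))
      fun z _ => hprodm g z
    convert this using 1
    funext x
    simp [S, Finset.sup'_apply]
  have hSpos : ∀ g x, 0 < S g x := fun g x => by
    obtain ⟨z, hz⟩ := hT
    exact lt_of_lt_of_le (Finset.prod_pos fun a _ => tilt_pos h0 h1 z (x a))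
      (Finset.le_sup' (fun z => ∏ a, tilt ν γ z (x a)) hz)
  have hS : ∀ g, ∫⁻ x, ENNReal.ofReal (S g x ^ q) ∂(Measure.pi fun _ => ν)
      ≤ ENNReal.ofReal (1 / (1 - q)) := fun g => by
    refine lintegral_rpow_le_of_tail (fun x => (hSpos g x).le) (hSm g) (fun a ha => ?_) hq0 hq1
    refine le_trans (measure_mono fun x hx => ?_) (meas_exists_prod_tilt_gt_le h0 h1 hp T ha)
    simpa [S, Finset.lt_sup'_iff] using hx
  let F : β → Ω → ENNReal := fun g ω => ENNReal.ofReal (S g (fun a => Y a ω) ^ q)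
  have hFm : ∀ g ∈ Λ, AEMeasurable (F g) P := fun g hg =>
    (((hSm g).pow_const q).ennreal_ofReal).comp_aemeasurable (hlaw g hg).aemeasurable
  have hFint : ∫⁻ ω, ∑ g ∈ Λ, F g ω ∂P ≤ Λ.card * ENNReal.ofReal (1 / (1 - q)) := by
    rw [lintegral_finsetSum' _ hFm, ← nsmul_eq_mul]
    refine Finset.sum_le_card_nsmul _ _ _ fun g hg => ?_
    have := (hlaw g hg).lintegral_comp (f := fun x => ENNReal.ofReal (S g x ^ q))
      ((hSm g).pow_const q).ennreal_ofReal.aemeasurable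
    exact this.trans_le (hS g)
  have hcard : (0 : ℝ) < Λ.card := by exact_mod_cast hΛ.card_pos
  set E := Real.exp (q * y / Λ.card) with hE
  have hEpos : 0 < E := Real.exp_pos _
  have hsub : {ω | ∃ z ∈ T, y < ∑ a ∈ s, Real.log (tilt ν γ z (Y a ω))}
      ⊆ {ω | ENNReal.ofReal (Λ.card * E) ≤ ∑ g ∈ Λ, F g ω} := by
    rintro ω ⟨z, hz, hy⟩
    have hfib : ∑ a ∈ s, Real.log (tilt ν γ z (Y a ω))
        = ∑ g ∈ Λ, Real.log (∏ a : {a // a ∈ s.filter fun a => label a = g},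
            tilt ν γ z (Y a ω)) := by
      rw [← Finset.sum_fiberwise_of_maps_to hmaps]
      refine Finset.sum_congr rfl fun g _ => ?_
      rw [Real.log_prod fun a _ => (tilt_pos h0 h1 _ _).ne', ← Finset.sum_coe_sort]
    -- the exponential of the average over the groups is at most the average of the exponentials
    have hjensen := convexOn_exp.map_sum_le (t := Λ) (w := fun _ => (1 : ℝ) / Λ.card)
      (p := fun g => q * Real.log (∏ a : {a // a ∈ s.filter fun a => label a = g},
            tilt ν γ z (Y a ω))) (fun _ _ => by positivity)
      (by rw [Finset.sum_const, nsmul_eq_mul]; field_simp) (fun _ _ => Set.mem_univ _)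
    have hle : E ≤ (1 / Λ.card) * ∑ g ∈ Λ, S g (fun a => Y a ω) ^ q := by
      calc E ≤ Real.exp (∑ g ∈ Λ, (1 / (Λ.card : ℝ)) • (q * Real.log
            (∏ a : {a // a ∈ s.filter fun a => label a = g}, tilt ν γ z (Y a ω)))) := by
            refine Real.exp_le_exp.2 ?_
            rw [← Finset.smul_sum, ← Finset.mul_sum, ← hfib, smul_eq_mul, one_div_mul_eq_div]
            gcongr
        _ ≤ _ := hjensen
        _ ≤ _ := by
            rw [Finset.mul_sum]
            refine Finset.sum_le_sum fun g _ => ?_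
            rw [smul_eq_mul]
            gcongr
            have hpos : 0 < ∏ a : {a // a ∈ s.filter fun a => label a = g},
              tilt ν γ z (Y a ω) := Finset.prod_pos fun a _ => tilt_pos h0 h1 _ _
            rw [mul_comm, ← Real.rpow_def_of_pos hpos]
            exact Real.rpow_le_rpow hpos.le (Finset.le_sup' (fun z =>
              ∏ a : {a // a ∈ s.filter fun a => label a = g}, tilt ν γ z (Y a ω)) hz) hq0.le
    change ENNReal.ofReal (Λ.card * E) ≤ ∑ g ∈ Λ, F g ω
    rw [← ENNReal.ofReal_sum_of_nonneg fun g _ => Real.rpow_nonneg (hSpos g _).le _]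
    refine ENNReal.ofReal_le_ofReal ?_
    rw [one_div_mul_eq_div, le_div_iff₀ hcard] at hle
    linarith
  refine (measure_mono hsub).trans ?_
  have hmk := (mul_meas_ge_le_lintegral₀ (Λ.aemeasurable_fun_sum hFm)
    (ENNReal.ofReal (Λ.card * E))).trans hFint
  have hpos : 0 < Λ.card * E := by positivity
  rw [mul_comm, ← ENNReal.le_div_iff_mul_le (Or.inl (ENNReal.ofReal_pos.2 hpos).ne')
    (Or.inl ENNReal.ofReal_ne_top)] at hmk
  refine hmk.trans (le_of_eq ?_)
  rw [← ENNReal.ofReal_natCast, ← ENNReal.ofReal_mul hcard.le, ← ENNReal.ofReal_div_of_pos hpos,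
    Real.exp_neg, ← hE]
  congr 1
  field_simp

/-- The bound of `meas_exists_finset_sum_log_tilt_gt_le` does not depend on the finite set of
thresholds, so it holds for all rational thresholds. -/
lemma meas_exists_rat_sum_log_tilt_gt_le (h0 : 0 ≤ γ) (h1 : γ < 1)
    (hp : ∀ z, 0 < ν.real (Set.Ici z)) {s : Finset α} {label : α → β} {Λ : Finset β}
    (hmaps : ∀ a ∈ s, label a ∈ Λ) (hΛ : Λ.Nonempty) {Y : α → Ω → ℝ}
    (hlaw : ∀ g ∈ Λ, HasLaw (fun ω (a : {a // a ∈ s.filter fun a => label a = g}) => Y a ω)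
      (Measure.pi fun _ => ν) P)
    {q : ℝ} (hq0 : 0 < q) (hq1 : q < 1) (y : ℝ) :
    P {ω | ∃ z : ℚ, y < ∑ a ∈ s, Real.log (tilt ν γ z (Y a ω))}
      ≤ ENNReal.ofReal (1 / (1 - q) * Real.exp (-(q * y / Λ.card))) := by
  classical
  have hU : {ω | ∃ z : ℚ, y < ∑ a ∈ s, Real.log (tilt ν γ z (Y a ω))}
      = ⋃ T : Finset ℚ, {ω | ∃ z ∈ T.image ((↑) : ℚ → ℝ),
          y < ∑ a ∈ s, Real.log (tilt ν γ z (Y a ω))} := by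
    ext ω
    simp only [Set.mem_ofPred_eq, Set.mem_iUnion]
    constructor
    · rintro ⟨z, hz⟩
      exact ⟨{z}, z, by simp, hz⟩
    · rintro ⟨T, z, hz, h⟩
      obtain ⟨z', -, rfl⟩ := Finset.mem_image.1 hz
      exact ⟨z', h⟩
  rw [hU, Directed.measure_iUnion]
  · exact iSup_le fun T =>
      meas_exists_finset_sum_log_tilt_gt_le h0 h1 hp hmaps hΛ hlaw hq0 hq1 y _
  · refine Monotone.directed_le fun T T' h ω => ?_
    rintro ⟨z, hz, h'⟩
    exact ⟨z, Finset.image_subset_image h hz, h'⟩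

end Groups

/-! ### Gaussian p-values -/

section PValue

instance nullSingletonClass_stdGaussian : NullSingletonClass (gaussianReal 0 1) :=
  nullSingletonClass_gaussianReal one_ne_zero

lemma gaussianReal_Ico_pos {a b : ℝ} (h : a < b) :
    0 < (gaussianReal 0 1).real (Set.Ico a b) := by
  have : (gaussianReal 0 1).IsOpenPosMeasure :=
    (gaussianReal_absolutelyContinuous' 0 one_ne_zero).isOpenPosMeasure
  rw [measureReal_def, ENNReal.toReal_pos_iff]
  refine ⟨?_, measure_lt_top _ _⟩
  exact lt_of_lt_of_le (isOpen_Ioo.measure_pos _ (Set.nonempty_Ioo.2 h))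
    (measure_mono Set.Ioo_subset_Ico_self)

lemma pValue_eq_add {a b : ℝ} (h : a ≤ b) :
    pValue a = (gaussianReal 0 1).real (Set.Ico a b) + pValue b := by
  unfold pValue
  have hdisj : Disjoint (Set.Ico a b) (Set.Ici b) :=
    Set.disjoint_left.2 fun x hx hx' => not_le.2 hx.2 hx'
  rw [← Set.Ico_union_Ici_eq_Ici h, measureReal_union hdisj measurableSet_Ici]

lemma pValue_strictAnti : StrictAnti pValue := fun a b h => by
  rw [pValue_eq_add h.le]
  linarith [gaussianReal_Ico_pos h]

lemma pValue_pos (z : ℝ) : 0 < pValue z :=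
  lt_of_le_of_lt measureReal_nonneg (pValue_strictAnti (lt_add_one z))

lemma pValue_lt_one (z : ℝ) : pValue z < 1 :=
  lt_of_lt_of_le (pValue_strictAnti (sub_one_lt z)) measureReal_le_one

lemma pValue_eq_one_sub_cdf (z : ℝ) : pValue z = 1 - cdf (gaussianReal 0 1) z := by
  rw [cdf_eq_real, ← probReal_compl_eq_one_sub measurableSet_Iic, Set.compl_Iic, pValue]
  exact measureReal_congr Ioi_ae_eq_Ici.symm

lemma continuous_pValue : Continuous pValue := by
  have : pValue = fun z => 1 - cdf (gaussianReal 0 1) z := funext pValue_eq_one_sub_cdf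
  rw [this]
  refine continuous_const.sub ?_
  rw [continuous_iff_continuousAt]
  intro z
  rw [(monotone_cdf _).continuousAt_iff_leftLim_eq_rightLim,
    (cdf (gaussianReal 0 1)).rightLim_eq]
  have h := (cdf (gaussianReal 0 1)).measure_singleton z
  rw [measure_cdf, measure_singleton, eq_comm, ENNReal.ofReal_eq_zero] at h
  have := (monotone_cdf (gaussianReal 0 1)).leftLim_le (le_refl z)
  linarith

lemma exists_pValue_eq {τ : ℝ} (h0 : 0 < τ) (h1 : τ < 1) : ∃ z, pValue z = τ := by
  have hfun : pValue = fun z => 1 - cdf (gaussianReal 0 1) z := funext pValue_eq_one_sub_cdf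
  have hbot : Tendsto pValue atBot (𝓝 1) := by
    rw [hfun]; simpa using (tendsto_cdf_atBot (gaussianReal 0 1)).const_sub 1
  have htop : Tendsto pValue atTop (𝓝 0) := by
    rw [hfun]; simpa using (tendsto_cdf_atTop (gaussianReal 0 1)).const_sub 1
  obtain ⟨a, ha⟩ := (hbot.eventually (lt_mem_nhds h1)).exists
  obtain ⟨b, hb⟩ := (htop.eventually (gt_mem_nhds h0)).exists
  exact mem_range_of_exists_le_of_exists_ge continuous_pValue ⟨b, hb.le⟩ ⟨a, ha.le⟩

variable {Ω : Type*} [MeasurableSpace Ω] {P : Measure Ω} {Z : Ω → ℝ}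

/-- The p-value of a standard normal variable is uniform on `(0, 1)`. -/
lemma meas_pValue_le (hZ : HasLaw Z (gaussianReal 0 1) P) {τ : ℝ} (h0 : 0 < τ) (h1 : τ < 1) :
    P {ω | pValue (Z ω) ≤ τ} = ENNReal.ofReal τ := by
  obtain ⟨z, rfl⟩ := exists_pValue_eq h0 h1
  simp_rw [pValue_strictAnti.le_iff_ge]
  rw [hZ.measure_eq (p := fun x => z ≤ x) measurableSet_Ici, pValue, ofReal_measureReal]
  rfl

lemma meas_le_pValue (hZ : HasLaw Z (gaussianReal 0 1) P) {τ : ℝ} (h0 : 0 < τ) (h1 : τ < 1) :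
    P {ω | τ ≤ pValue (Z ω)} = ENNReal.ofReal (1 - τ) := by
  obtain ⟨z, rfl⟩ := exists_pValue_eq h0 h1
  simp_rw [pValue_strictAnti.le_iff_ge]
  rw [hZ.measure_eq (p := fun x => x ≤ z) measurableSet_Iic, pValue_eq_one_sub_cdf, sub_sub_cancel,
    ofReal_cdf]
  rfl

end PValue

/-! ### Bernoulli relative entropy, exponential rates and order statistics -/

/-- The relative entropy of the Bernoulli law with parameter `f` with respect to the one with
parameter `t`, for `f` and `t` in `(0, 1)`. -/
noncomputable def bernKL (f t : ℝ) : ℝ :=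
  f * Real.log (f / t) + (1 - f) * Real.log ((1 - f) / (1 - t))

/-- The normalized logarithm of a product of `tilt` weights when a fraction `f` of the observations
lies above a threshold of tail probability `t`; see `sum_log_tilt_eq`. -/
noncomputable def tiltRate (γ f t : ℝ) : ℝ :=
  f * Real.log (1 + γ * (1 - t) / t) + (1 - f) * Real.log (1 - γ)

lemma mul_log_le_log_convex {c x : ℝ} (hc0 : 0 ≤ c) (hc1 : c ≤ 1) (hx : 0 < x) :
    c * Real.log x ≤ Real.log (1 + c * (x - 1)) := by
  have := strictConcaveOn_log_Ioi.concaveOn.2 (Set.mem_Ioi.2 hx) (Set.mem_Ioi.2 one_pos) hc0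
    (sub_nonneg.2 hc1) (by ring)
  simp only [smul_eq_mul, Real.log_one, mul_zero, add_zero, mul_one] at this
  rwa [show 1 + c * (x - 1) = c * x + (1 - c) by ring]

/-- Concavity of `tiltRate` in its first argument, between `0` and the maximizer
`(f - t) / (1 - t)`, where it equals `bernKL f t`. -/
lemma mul_bernKL_le_tiltRate {c f t : ℝ} (ht : 0 < t) (htf : t < f) (hf : f < 1) (hc0 : 0 ≤ c)
    (hc1 : c ≤ 1) : c * bernKL f t ≤ tiltRate (c * ((f - t) / (1 - t))) f t := by
  have ht1 : 0 < 1 - t := by linarith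
  have hft : 0 < f / t := div_pos (ht.trans htf) ht
  have hft' : 0 < (1 - f) / (1 - t) := div_pos (by linarith) ht1
  have e1 : 1 + c * ((f - t) / (1 - t)) * (1 - t) / t = 1 + c * (f / t - 1) := by field_simp
  have e2 : 1 - c * ((f - t) / (1 - t)) = 1 + c * ((1 - f) / (1 - t) - 1) := by
    field_simp; ring
  unfold bernKL tiltRate
  rw [e1, e2]
  have h1 := mul_le_mul_of_nonneg_left (mul_log_le_log_convex hc0 hc1 hft) (by linarith : 0 ≤ f)
  have h2 := mul_le_mul_of_nonneg_left (mul_log_le_log_convex hc0 hc1 hft')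
    (by linarith : 0 ≤ 1 - f)
  linarith

lemma tiltRate_mono {γ f g t : ℝ} (hγ0 : 0 ≤ γ) (hγ1 : γ < 1) (ht0 : 0 < t) (ht1 : t < 1)
    (hfg : f ≤ g) : tiltRate γ f t ≤ tiltRate γ g t := by
  have h1 : 0 ≤ Real.log (1 + γ * (1 - t) / t) := Real.log_nonneg (by
    have : 0 ≤ γ * (1 - t) / t := div_nonneg (mul_nonneg hγ0 (by linarith)) ht0.le
    linarith)
  have h2 : Real.log (1 - γ) ≤ 0 := Real.log_nonpos (by linarith) (by linarith)
  unfold tiltRate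
  nlinarith

lemma bernKL_lower {f t : ℝ} (ht : 0 < t) (htf : t < f) (hf : f < 1) :
    (f - t) ^ 2 / (2 * f) ≤ bernKL f t := by
  have hf0 : 0 < f := ht.trans htf
  set u := (f - t) / f with hu
  have hu0 : 0 ≤ u := div_nonneg (by linarith) hf0.le
  have hu1 : u < 1 := by rw [hu, div_lt_one hf0]; linarith
  have h1 : u + u ^ 2 / 2 ≤ Real.log (f / t) := by
    have hs := Real.hasSum_pow_div_log_of_abs_lt_one (x := u) (by rw [abs_of_nonneg hu0]; exact hu1)
    -- the first two terms of the series of `-log (1 - u)`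
    have h := sum_le_hasSum (Finset.range 2) (fun i _ => by positivity) hs
    have e : f / t = (1 - u)⁻¹ := by
      rw [show 1 - u = t / f by rw [hu]; field_simp; ring, inv_div]
    rw [e, Real.log_inv]
    simp only [Finset.sum_range_succ, Finset.sum_range_zero] at h
    norm_num at h
    linarith
  have hf1 : 0 < 1 - f := by linarith
  have ht1 : 0 < 1 - t := by linarith
  have h2 : 1 - (1 - t) / (1 - f) ≤ Real.log ((1 - f) / (1 - t)) := by
    have := Real.one_sub_inv_le_log_of_pos (div_pos hf1 ht1)
    rwa [inv_div] at this
  have h1' := mul_le_mul_of_nonneg_left h1 hf0.le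
  have h2' := mul_le_mul_of_nonneg_left h2 hf1.le
  have e1 : f * (u + u ^ 2 / 2) = (f - t) + (f - t) ^ 2 / (2 * f) := by
    rw [hu]; field_simp
  have e2 : (1 - f) * (1 - (1 - t) / (1 - f)) = -(f - t) := by field_simp; ring
  unfold bernKL
  linarith

lemma bernKL_nonneg {f t : ℝ} (ht : 0 < t) (htf : t < f) (hf : f < 1) : 0 ≤ bernKL f t :=
  le_trans (div_nonneg (sq_nonneg _) (by linarith)) (bernKL_lower ht htf hf)

lemma bernKL_upper {f t : ℝ} (ht : 0 < t) (htf : t < f) (hf : f < 1) :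
    bernKL f t ≤ f * (f - t) / t := by
  have hf0 : 0 < f := ht.trans htf
  have ht1 : 0 < 1 - t := by linarith
  have h1 : Real.log (f / t) ≤ f / t - 1 := Real.log_le_sub_one_of_pos (by positivity)
  have h2 : Real.log ((1 - f) / (1 - t)) ≤ 0 :=
    Real.log_nonpos (div_nonneg (by linarith) ht1.le) ((div_le_one ht1).2 (by linarith))
  have h1' := mul_le_mul_of_nonneg_left h1 hf0.le
  have h2' := mul_nonpos_of_nonneg_of_nonpos (by linarith : 0 ≤ 1 - f) h2
  have e : f * (f / t - 1) = f * (f - t) / t := by field_simp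
  unfold bernKL
  linarith

/-- A squared weighted higher criticism term is controlled by the relative entropy and a lower
bound on the p-value. For `f ≤ 2 t` the entropy suffices; otherwise it gives `v f ≤ 8 x`, and the
lower bound on `t` controls the ratio `f / t`. -/
lemma hc_sq_le {v A x f t : ℝ} (hv : 0 < v) (hA : 0 < A) (ht : 0 < t) (htf : t < f)
    (hf : f ≤ 1 / 2) (hx : v * bernKL f t ≤ x) (htA : 1 / (v * A) ≤ t) :
    v * ((f - t) ^ 2 / (t * (1 - t))) ≤ 8 * x + 32 * x ^ 2 * A := by
  have hf0 : 0 < f := ht.trans htf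
  have hx0 : 0 ≤ x := le_trans (mul_nonneg hv.le (bernKL_nonneg ht htf (by linarith))) hx
  have h1 : v * (f - t) ^ 2 ≤ 2 * f * x := by
    have := (mul_le_mul_of_nonneg_left (bernKL_lower ht htf (by linarith)) hv.le).trans hx
    rw [← mul_div_assoc, div_le_iff₀ (by positivity)] at this
    linarith
  have h2 : v * ((f - t) ^ 2 / (t * (1 - t))) ≤ 4 * x * (f / t) := by
    rw [← mul_div_assoc, div_le_iff₀ (mul_pos ht (by linarith))]
    calc v * (f - t) ^ 2 ≤ 2 * f * x := h1
      _ ≤ 4 * x * f * (1 - t) := by nlinarith [mul_nonneg hf0.le hx0]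
      _ = 4 * x * (f / t) * (t * (1 - t)) := by field_simp
  refine h2.trans ?_
  by_cases hft : f ≤ 2 * t
  · have : f / t ≤ 2 := (div_le_iff₀ ht).2 hft
    nlinarith [mul_nonneg hx0 hA.le, mul_nonneg (mul_nonneg hx0 hx0) hA.le]
  · push Not at hft
    have h3 : v * f ≤ 8 * x := by
      have : f * (v * f) ≤ f * (8 * x) := by
        have h := mul_le_mul_of_nonneg_left
          (pow_le_pow_left₀ (by linarith) (by linarith : f / 2 ≤ f - t) 2) hv.le
        linarith
      exact le_of_mul_le_mul_left this hf0
    have h4 : 1 ≤ t * (v * A) := (div_le_iff₀ (by positivity)).1 htA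
    have h5 : f / t ≤ 8 * x * A := by
      rw [div_le_iff₀ ht]
      calc f ≤ f * (t * (v * A)) := le_mul_of_one_le_right hf0.le h4
        _ = (v * f) * (A * t) := by ring
        _ ≤ 8 * x * (A * t) := by gcongr
        _ = _ := by ring
    nlinarith [mul_nonneg hx0 hA.le]

section OrderStat

variable {α : Type*} {s : Finset α} {p : α → ℝ} {i : ℕ}

/-- The infimum in the definition of `orderStat` is attained at one of the values. -/
lemma exists_orderStat_eq (hi : 1 ≤ i) (his : i ≤ s.card) :
    ∃ a ∈ s, orderStat s p i = p a ∧ i ≤ (s.filter fun b => p b ≤ p a).card := by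
  have hs : s.Nonempty := Finset.card_pos.1 (by omega)
  have hT : (s.filter fun a => i ≤ (s.filter fun b => p b ≤ p a).card).Nonempty := by
    obtain ⟨a, ha, hmax⟩ := s.exists_max_image p hs
    refine ⟨a, Finset.mem_filter.2 ⟨ha, ?_⟩⟩
    rwa [Finset.filter_true_of_mem hmax]
  obtain ⟨a, ha, hmin⟩ := Finset.exists_min_image _ p hT
  obtain ⟨has, hai⟩ := Finset.mem_filter.1 ha
  refine ⟨a, has, IsLeast.csInf_eq ⟨hai, fun t ht => ?_⟩, hai⟩
  have ht' : i ≤ (s.filter fun b => p b ≤ t).card := ht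
  obtain ⟨b, hb, hbmax⟩ := Finset.exists_max_image (s.filter fun b => p b ≤ t) p
    (Finset.card_pos.1 (by omega))
  obtain ⟨hbs, hbt⟩ := Finset.mem_filter.1 hb
  refine (hmin b (Finset.mem_filter.2 ⟨hbs, ht'.trans (Finset.card_le_card fun c hc => ?_)⟩)).trans
    hbt
  exact Finset.mem_filter.2 ⟨(Finset.mem_filter.1 hc).1, hbmax c hc⟩

lemma orderStat_one_le {a : α} (ha : a ∈ s) : orderStat s p 1 ≤ p a := by
  obtain ⟨b, hb, hmin⟩ := s.exists_min_image p ⟨a, ha⟩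
  refine csInf_le ⟨p b, fun t ht => ?_⟩ (Finset.card_pos.2 ⟨a, by simp [ha]⟩)
  have ht' : 1 ≤ (s.filter fun b => p b ≤ t).card := ht
  obtain ⟨c, hc⟩ := Finset.card_pos.1 ht'
  obtain ⟨hcs, hct⟩ := Finset.mem_filter.1 hc
  exact (hmin c hcs).trans hct

lemma sum_log_tilt_eq (Y : α → ℝ) (γ z : ℝ) (hs : s.Nonempty) :
    ∑ a ∈ s, Real.log (tilt (gaussianReal 0 1) γ z (Y a))
      = s.card * tiltRate γ ((s.filter fun a => z ≤ Y a).card / s.card) (pValue z) := by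
  have h1 : ∀ a ∈ s, Real.log (tilt (gaussianReal 0 1) γ z (Y a))
      = if z ≤ Y a then Real.log (1 + γ * (1 - pValue z) / pValue z) else Real.log (1 - γ) := by
    intro a _
    unfold tilt pValue
    split_ifs <;> rfl
  have hcard : (s.card : ℝ) ≠ 0 := by exact_mod_cast hs.card_pos.ne'
  have hadd : ((s.filter fun a => z ≤ Y a).card : ℝ) + (s.filter fun a => ¬ z ≤ Y a).card
      = s.card := by
    exact_mod_cast Finset.card_filter_add_card_filter_not (s := s) fun a => z ≤ Y a
  rw [Finset.sum_congr rfl h1, Finset.sum_ite, Finset.sum_const, Finset.sum_const, nsmul_eq_mul,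
    nsmul_eq_mul, tiltRate]
  rw [show ((s.filter fun a => ¬ z ≤ Y a).card : ℝ) = s.card - (s.filter fun a => z ≤ Y a).card by
    linarith]
  field_simp

/-- If the rate at the `i`-th order statistic is large, then the log-likelihood ratio is large at
some rational threshold: slightly below the corresponding observation, the tail probability has
hardly changed and at least as many observations lie above. -/
lemma exists_rat_lt_sum_log_tilt (Y : α → ℝ) {γ y : ℝ} (hγ0 : 0 ≤ γ) (hγ1 : γ < 1) (hi : 1 ≤ i)
    (his : i ≤ s.card)
    (hy : y < s.card * tiltRate γ (i / s.card) (orderStat s (fun a => pValue (Y a)) i)) :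
    ∃ z : ℚ, y < ∑ a ∈ s, Real.log (tilt (gaussianReal 0 1) γ z (Y a)) := by
  have hs : s.Nonempty := Finset.card_pos.1 (by omega)
  obtain ⟨a, has, hat, hia⟩ := exists_orderStat_eq (p := fun a => pValue (Y a)) hi his
  rw [hat] at hy
  have hcont : Continuous fun z => (s.card : ℝ) * tiltRate γ (i / s.card) (pValue z) := by
    unfold tiltRate
    have h0 : ∀ z, pValue z ≠ 0 := fun z => (pValue_pos z).ne'
    have h1 : ∀ z, 1 + γ * (1 - pValue z) / pValue z ≠ 0 := fun z => by
      have : 0 ≤ γ * (1 - pValue z) / pValue z :=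
        div_nonneg (mul_nonneg hγ0 (by linarith [pValue_lt_one z])) (pValue_pos z).le
      linarith
    have hc : Continuous fun z => 1 + γ * (1 - pValue z) / pValue z :=
      continuous_const.add ((continuous_const.mul (continuous_const.sub continuous_pValue)).div
        continuous_pValue h0)
    exact continuous_const.mul ((continuous_const.mul (hc.log h1)).add continuous_const)
  obtain ⟨δ, hδ, hball⟩ := Metric.eventually_nhds_iff.1
    (hcont.continuousAt.eventually (lt_mem_nhds hy))
  obtain ⟨z, hz1, hz2⟩ := exists_rat_btwn (sub_lt_self (Y a) hδ)
  refine ⟨z, ?_⟩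
  rw [sum_log_tilt_eq Y γ z hs]
  have hz := hball (y := (z : ℝ)) (by rw [Real.dist_eq, abs_lt]; constructor <;> linarith)
  refine hz.trans_le (mul_le_mul_of_nonneg_left ?_ (Nat.cast_nonneg _))
  refine tiltRate_mono hγ0 hγ1 (pValue_pos _) (pValue_lt_one _) ?_
  gcongr
  refine hia.trans (Finset.card_le_card fun b hb => ?_)
  obtain ⟨hbs, hb'⟩ := Finset.mem_filter.1 hb
  exact Finset.mem_filter.2 ⟨hbs, hz2.le.trans (pValue_strictAnti.le_iff_ge.1 hb')⟩

end OrderStat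

/-! ### Splitting the intervals of one level into groups of disjoint intervals -/

section Combinatorics

variable {n l : ℕ}

/-- The possible lengths of the intervals of level `l`: the multiples of the grid spacing in
`(2 ^ (l - 1), 2 ^ l]`. -/
noncomputable def intervalLengths (n l : ℕ) : Finset ℕ :=
  (Finset.range (2 ^ l + 1)).filter fun r => gridStep n l ∣ r ∧ 2 ^ l < 2 * r

/-- The group of an interval: its left end in units of the grid spacing, modulo the largest
possible length, and its length. -/
noncomputable def intervalLabel (n l : ℕ) (I : ℕ × ℕ) : ℕ × ℕ :=
  (I.1 / gridStep n l % (2 ^ l / gridStep n l), I.2 - I.1)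

/-- The set of all groups of level `l`. -/
noncomputable def intervalLabels (n l : ℕ) : Finset (ℕ × ℕ) :=
  Finset.range (2 ^ l / gridStep n l) ×ˢ intervalLengths n l

lemma mem_approxIntervals {I : ℕ × ℕ} : I ∈ approxIntervals n l ↔
    I.1 ≤ n ∧ I.2 ≤ n ∧ gridStep n l ∣ I.1 ∧ gridStep n l ∣ I.2 ∧
      2 * I.1 + 2 ^ l < 2 * I.2 ∧ I.2 ≤ I.1 + 2 ^ l := by
  simp [approxIntervals, and_assoc]

lemma lt_of_mem_approxIntervals {I : ℕ × ℕ} (hI : I ∈ approxIntervals n l) : I.1 < I.2 := by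
  obtain ⟨-, -, -, -, h, -⟩ := mem_approxIntervals.1 hI
  have h2 : 0 < 2 ^ l := Nat.two_pow_pos l
  omega

lemma gridStep_pos_of_mem {I : ℕ × ℕ} (hI : I ∈ approxIntervals n l) : 0 < gridStep n l := by
  obtain ⟨-, -, -, h2, -⟩ := mem_approxIntervals.1 hI
  have := lt_of_mem_approxIntervals hI
  rcases Nat.eq_zero_or_pos (gridStep n l) with h | h
  · rw [h, zero_dvd_iff] at h2; omega
  · exact h

lemma sub_mem_intervalLengths {I : ℕ × ℕ} (hI : I ∈ approxIntervals n l) :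
    I.2 - I.1 ∈ intervalLengths n l := by
  obtain ⟨-, -, h1, h2, h3, h4⟩ := mem_approxIntervals.1 hI
  simp only [intervalLengths, Finset.mem_filter, Finset.mem_range]
  exact ⟨by omega, Nat.dvd_sub h2 h1, by omega⟩

lemma le_mul_of_mem_intervalLengths {r : ℕ} (hr : r ∈ intervalLengths n l) :
    r ≤ gridStep n l * (2 ^ l / gridStep n l) := by
  simp only [intervalLengths, Finset.mem_filter, Finset.mem_range] at hr
  obtain ⟨hr1, ⟨q, rfl⟩, -⟩ := hr
  rcases Nat.eq_zero_or_pos (gridStep n l) with h | h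
  · simp [h]
  · refine Nat.mul_le_mul_left _ ((Nat.le_div_iff_mul_le h).2 ?_)
    rw [mul_comm]; omega

lemma intervalLabel_mem {I : ℕ × ℕ} (hI : I ∈ approxIntervals n l) :
    intervalLabel n l I ∈ intervalLabels n l := by
  refine Finset.mem_product.2 ⟨Finset.mem_range.2 (Nat.mod_lt _ ?_), sub_mem_intervalLengths hI⟩
  have h1 := le_mul_of_mem_intervalLengths (sub_mem_intervalLengths hI)
  have h2 := lt_of_mem_approxIntervals hI
  refine Nat.pos_of_ne_zero fun h => ?_
  rw [h, mul_zero] at h1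
  omega

lemma le_of_intervalLabel_eq_of_lt {I J : ℕ × ℕ} (hI : I ∈ approxIntervals n l)
    (hJ : J ∈ approxIntervals n l) (h : intervalLabel n l I = intervalLabel n l J)
    (hlt : I.1 < J.1) : I.2 ≤ J.1 := by
  obtain ⟨-, -, ⟨a, ha⟩, -⟩ := mem_approxIntervals.1 hI
  obtain ⟨-, -, ⟨b, hb⟩, -⟩ := mem_approxIntervals.1 hJ
  have hd := gridStep_pos_of_mem hI
  have hI2 := lt_of_mem_approxIntervals hI
  have hr := le_mul_of_mem_intervalLengths (sub_mem_intervalLengths hI)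
  have hmod := congrArg Prod.fst h
  simp only [intervalLabel] at hmod
  set K := 2 ^ l / gridStep n l
  rw [ha, hb, Nat.mul_div_cancel_left _ hd, Nat.mul_div_cancel_left _ hd] at hmod
  have hab : a < b := by
    rw [ha, hb] at hlt
    exact lt_of_mul_lt_mul_left hlt (Nat.zero_le _)
  have hdvd : K ∣ b - a := (Nat.modEq_iff_dvd' hab.le).1 hmod
  have hKle : K ≤ b - a := Nat.le_of_dvd (by omega) hdvd
  have h1 : gridStep n l * K ≤ gridStep n l * (b - a) := Nat.mul_le_mul_left _ hKle
  rw [Nat.mul_sub, ← ha, ← hb] at h1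
  omega

lemma disjoint_of_intervalLabel_eq {I J : ℕ × ℕ} (hI : I ∈ approxIntervals n l)
    (hJ : J ∈ approxIntervals n l) (h : intervalLabel n l I = intervalLabel n l J) (hne : I ≠ J) :
    Disjoint (Finset.Ioc I.1 I.2) (Finset.Ioc J.1 J.2) := by
  have key : I.2 ≤ J.1 ∨ J.2 ≤ I.1 := by
    rcases lt_trichotomy I.1 J.1 with hlt | heq | hgt
    · exact Or.inl (le_of_intervalLabel_eq_of_lt hI hJ h hlt)
    · refine absurd (Prod.ext heq ?_) hne
      have h2 := congrArg Prod.snd h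
      simp only [intervalLabel] at h2
      have := lt_of_mem_approxIntervals hI
      have := lt_of_mem_approxIntervals hJ
      omega
    · exact Or.inr (le_of_intervalLabel_eq_of_lt hJ hI h.symm hgt)
  refine Finset.disjoint_left.2 fun x hx hx' => ?_
  rw [Finset.mem_Ioc] at hx hx'
  omega

lemma card_lengths_mul_le (hl : 2 ^ l ≤ n) (hd : 0 < gridStep n l) :
    (intervalLengths n l).card * ((n - 2 ^ l) / gridStep n l + 1) ≤ (approxIntervals n l).card := by
  rw [← Finset.card_range ((n - 2 ^ l) / gridStep n l + 1), ← Finset.card_product]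
  refine Finset.card_le_card_of_injOn
    (fun q => (gridStep n l * q.2, gridStep n l * q.2 + q.1)) ?_ ?_
  · rintro ⟨r, a⟩ h
    simp only [Finset.coe_product, Set.mem_prod, Finset.mem_coe, intervalLengths,
      Finset.mem_filter, Finset.mem_range] at h
    obtain ⟨⟨hr, hdr, hr2⟩, ha⟩ := h
    have h1 : gridStep n l * a ≤ n - 2 ^ l :=
      (Nat.mul_le_mul_left _ (Nat.lt_succ_iff.1 ha)).trans (Nat.mul_div_le _ _)
    refine mem_approxIntervals.2
      ⟨?_, ?_, dvd_mul_right _ _, dvd_add (dvd_mul_right _ _) hdr, ?_, ?_⟩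
      <;> simp only <;> omega
  · rintro ⟨r, a⟩ - ⟨r', a'⟩ - h
    simp only [Prod.mk.injEq] at h
    obtain ⟨h1, h2⟩ := h
    have := Nat.eq_of_mul_eq_mul_left hd h1
    subst this
    simp only [Prod.mk.injEq, and_true]
    omega

/-- There are at most `(4 / 3) N 2 ^ l / n` groups, where `N` is the number of intervals: the
average group has at least `(3 / 4) n / 2 ^ l` elements. -/
lemma card_intervalLabels_mul_le (hl : 4 * 2 ^ l ≤ n) (hd : 0 < gridStep n l) :
    3 * n * (intervalLabels n l).card ≤ 4 * 2 ^ l * (approxIntervals n l).card := by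
  have h1 := card_lengths_mul_le (n := n) (l := l) (by omega) hd
  rw [intervalLabels, Finset.card_product, Finset.card_range]
  set d := gridStep n l
  set K := 2 ^ l / d
  set R := (intervalLengths n l).card
  have h2 : K * d ≤ 2 ^ l := Nat.div_mul_le_self _ _
  have h3 : n - 2 ^ l ≤ ((n - 2 ^ l) / d + 1) * d := by
    have := Nat.lt_succ_iff.2 (le_refl ((n - 2 ^ l) / d))
    exact ((Nat.div_lt_iff_lt_mul hd).1 this).le
  calc 3 * n * (K * R) ≤ 4 * (n - 2 ^ l) * (K * R) := Nat.mul_le_mul_right _ (by omega)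
    _ ≤ 4 * (((n - 2 ^ l) / d + 1) * d) * (K * R) := by gcongr
    _ = 4 * (K * d) * (R * ((n - 2 ^ l) / d + 1)) := by ring
    _ ≤ _ := by gcongr

lemma card_approxIntervals_mul_sq_le :
    (approxIntervals n l).card * gridStep n l ^ 2 ≤ 2 ^ l * n := by
  rcases (approxIntervals n l).eq_empty_or_nonempty with h | ⟨I₀, hI₀⟩
  · simp [h]
  have hd := gridStep_pos_of_mem hI₀
  set d := gridStep n l with hdd
  have hR : (intervalLengths n l).card ≤ 2 ^ l / d := by
    rw [← Finset.card_range (2 ^ l / d)]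
    refine Finset.card_le_card_of_injOn (fun r => r / d - 1) ?_ ?_
    · intro r hr
      have h1 := le_mul_of_mem_intervalLengths hr
      rw [← hdd] at h1
      simp only [intervalLengths, Finset.coe_filter, Finset.mem_range, Set.mem_ofPred_eq] at hr
      obtain ⟨-, ⟨q, rfl⟩, h3⟩ := hr
      rw [← hdd] at h1 h3 ⊢
      have hq := Nat.le_of_mul_le_mul_left h1 hd
      have hq0 : q ≠ 0 := by rintro rfl; simp at h3
      simp only [Nat.mul_div_cancel_left _ hd, Finset.coe_range, Set.mem_Iio]
      omega
    · intro r hr r' hr' h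
      simp only [intervalLengths, Finset.coe_filter, Finset.mem_range, Set.mem_ofPred_eq] at hr hr'
      obtain ⟨-, ⟨q, rfl⟩, h3⟩ := hr
      obtain ⟨-, ⟨q', rfl⟩, h3'⟩ := hr'
      rw [← hdd] at h h3 h3' ⊢
      simp only [Nat.mul_div_cancel_left _ hd] at h
      have hq0 : q ≠ 0 := by rintro rfl; simp at h3
      have hq0' : q' ≠ 0 := by rintro rfl; simp at h3'
      rw [show q = q' by omega]
  have hN : (approxIntervals n l).card ≤ (intervalLengths n l).card * (n / d) := by
    rw [← Finset.card_range (n / d), ← Finset.card_product]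
    refine Finset.card_le_card_of_injOn (fun I => (I.2 - I.1, I.1 / d)) ?_ ?_
    · intro I hI
      have h1 := lt_of_mem_approxIntervals hI
      have h2 := sub_mem_intervalLengths hI
      obtain ⟨-, h4, ⟨a, ha⟩, ⟨b, hb⟩, -⟩ := mem_approxIntervals.1 hI
      rw [← hdd] at ha hb
      simp only [Finset.coe_product, Set.mem_prod, Finset.mem_coe, Finset.mem_range]
      refine ⟨h2, ?_⟩
      rw [ha, Nat.mul_div_cancel_left _ hd]
      have hab : a < b := by
        rw [ha, hb] at h1
        exact lt_of_mul_lt_mul_left h1 (Nat.zero_le _)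
      exact lt_of_lt_of_le hab ((Nat.le_div_iff_mul_le hd).2 (by rw [mul_comm, ← hb]; exact h4))
    · intro I hI J hJ h
      have h1 := lt_of_mem_approxIntervals hI
      have h2 := lt_of_mem_approxIntervals hJ
      obtain ⟨-, -, ⟨a, ha⟩, -⟩ := mem_approxIntervals.1 hI
      obtain ⟨-, -, ⟨b, hb⟩, -⟩ := mem_approxIntervals.1 hJ
      simp only [Prod.mk.injEq] at h
      obtain ⟨h3, h4⟩ := h
      rw [← hdd] at ha hb
      rw [ha, hb, Nat.mul_div_cancel_left _ hd, Nat.mul_div_cancel_left _ hd] at h4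
      rw [h4, ← hb] at ha
      exact Prod.ext ha (by omega)
  calc (approxIntervals n l).card * d ^ 2 ≤ (2 ^ l / d * (n / d)) * d ^ 2 := by
        gcongr; exact hN.trans (Nat.mul_le_mul_right _ hR)
    _ = (2 ^ l / d * d) * (n / d * d) := by ring
    _ ≤ _ := Nat.mul_le_mul (Nat.div_mul_le_self _ _) (Nat.div_mul_le_self _ _)

lemma four_mul_two_pow_le (hn : 8 ≤ n) (hl : l ≤ maxLevel n) : 4 * 2 ^ l ≤ n := by
  have hn' : (8 : ℝ) ≤ n := by exact_mod_cast hn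
  have h0 : 0 ≤ Real.logb 2 ((n : ℝ) / 8) :=
    Real.logb_nonneg one_lt_two (by rw [le_div_iff₀] <;> linarith)
  have h1 : (l : ℝ) < Real.logb 2 ((n : ℝ) / 8) + 1 :=
    lt_of_le_of_lt (by exact_mod_cast hl) (Nat.ceil_lt_add_one h0)
  have h2 : Real.logb 2 ((n : ℝ) / 8) + 1 = Real.logb 2 ((n : ℝ) / 4) := by
    rw [← Real.logb_self_eq_one one_lt_two, ← Real.logb_mul (by positivity) two_ne_zero]
    congr 1; ring
  rw [h2, Real.lt_logb_iff_rpow_lt one_lt_two (by positivity), Real.rpow_natCast] at h1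
  have : (4 * 2 ^ l : ℝ) ≤ n := by linarith
  exact_mod_cast this

lemma le_eight_mul_two_pow_maxLevel (hn : 1 ≤ n) : n ≤ 8 * 2 ^ maxLevel n := by
  have hn' : (1 : ℝ) ≤ n := by exact_mod_cast hn
  have h1 : Real.logb 2 ((n : ℝ) / 8) ≤ maxLevel n := Nat.le_ceil _
  rw [Real.logb_le_iff_le_rpow one_lt_two (by positivity), Real.rpow_natCast] at h1
  have : (n : ℝ) ≤ 8 * 2 ^ maxLevel n := by linarith
  exact_mod_cast this

/-- This is where the size of the precision `ε_ℓ` enters: it bounds the number of intervals starting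
in a block of length `2 ^ l` by a multiple of `log n`. -/
lemma card_approxIntervals_le (hn : 8 ≤ n) (hl : l ≤ maxLevel n) :
    ((approxIntervals n l).card : ℝ) ≤ 144 * (n / 2 ^ l) * Real.logb 2 (2 * n) := by
  have h4 := four_mul_two_pow_le hn hl
  have hn' : (8 : ℝ) ≤ n := by exact_mod_cast hn
  have h4' : (4 * 2 ^ l : ℝ) ≤ n := by exact_mod_cast h4
  have hp : (0 : ℝ) < 2 ^ l := by positivity
  have hhalf : (2 : ℝ) ^ ((l : ℤ) - 1) = 2 ^ l / 2 := by
    rw [zpow_sub_one₀ two_ne_zero, zpow_natCast]; rfl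
  set Lg := Real.logb 2 ((n : ℝ) / (2 : ℝ) ^ ((l : ℤ) - 1)) with hLg
  have hLg0 : 0 < Lg := by
    refine Real.logb_pos one_lt_two ?_
    rw [hhalf, lt_div_iff₀ (by positivity)]
    linarith
  have hLgle : Lg ≤ Real.logb 2 (2 * n) := by
    refine Real.logb_le_logb_of_le one_lt_two (by rw [hhalf]; positivity) ?_
    rw [hhalf, div_le_iff₀ (by positivity)]
    have : (1 : ℝ) ≤ 2 ^ l := one_le_pow₀ one_le_two
    nlinarith
  have hd : precision n l * (2 ^ l / 2) ≤ gridStep n l := by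
    rw [← hhalf]; exact Nat.le_ceil _
  have hprec : precision n l ^ 2 = 1 / (36 * Lg) := by
    rw [precision, ← hLg, div_pow, mul_pow, Real.sq_sqrt hLg0.le]; norm_num
  have hprec0 : 0 ≤ precision n l := by unfold precision; positivity
  have hcount : ((approxIntervals n l).card : ℝ) * (gridStep n l : ℝ) ^ 2 ≤ 2 ^ l * n := by
    exact_mod_cast card_approxIntervals_mul_sq_le (n := n) (l := l)
  have h1 : ((approxIntervals n l).card : ℝ) * (precision n l * (2 ^ l / 2)) ^ 2 ≤ 2 ^ l * n :=
    le_trans (by gcongr) hcount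
  rw [mul_pow, hprec] at h1
  have h2 : ((approxIntervals n l).card : ℝ) ≤ 144 * (n / 2 ^ l) * Lg := by
    have e : ((approxIntervals n l).card : ℝ) * (1 / (36 * Lg) * (2 ^ l / 2) ^ 2)
        = (approxIntervals n l).card * (2 ^ l) ^ 2 / (144 * Lg) := by
      field_simp; ring
    rw [e, div_le_iff₀ (by positivity)] at h1
    rw [← mul_div_assoc, div_mul_eq_mul_div, le_div_iff₀ hp]
    nlinarith
  refine h2.trans ?_
  gcongr

end Combinatorics

/-! ### Joint law of the statistics of disjoint intervals -/

section Law

variable {Ω : Type*} [MeasurableSpace Ω] {P : Measure Ω} [IsProbabilityMeasure P]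

/-- Orthonormal linear combinations of independent standard normal variables are independent
standard normal variables. -/
lemma hasLaw_pi_of_orthonormal {κ ι : Type*} [Fintype κ] [Fintype ι] [DecidableEq ι]
    {Z : κ → Ω → ℝ} (hlaw : ∀ i, HasLaw (Z i) (gaussianReal 0 1) P) (hindep : iIndepFun Z P)
    (c : ι → κ → ℝ) (hc : ∀ a b, ∑ i, c a i * c b i = if a = b then 1 else 0) :
    HasLaw (fun ω a => ∑ i, c a i * Z i ω) (Measure.pi fun _ => gaussianReal 0 1) P := by
  classical
  have hG : ∀ i, HasGaussianLaw (Z i) P := fun i => (hlaw i).hasGaussianLaw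
  have hjoint : HasGaussianLaw (fun ω i => Z i ω) P := hindep.hasGaussianLaw hG
  have hlin : HasGaussianLaw (fun ω a => ∑ i, c a i * Z i ω) P := by
    have heq : (fun ω a => ∑ i, c a i * Z i ω) = fun ω => (ContinuousLinearMap.pi fun a : ι =>
        ∑ i, c a i • (ContinuousLinearMap.proj i : (κ → ℝ) →L[ℝ] ℝ)) fun i => Z i ω := by
      funext ω a
      simp
    rw [heq]
    exact hjoint.map_fun _
  have hcovZ : ∀ i j, cov[Z i, Z j; P] = if i = j then 1 else 0 := by
    intro i j
    split_ifs with h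
    · subst h
      rw [covariance_self (hlaw i).aemeasurable, (hlaw i).variance_eq, variance_id_gaussianReal]
      simp
    · exact (hindep.indepFun h).covariance_eq_zero (hG i).memLp_two (hG j).memLp_two
  have hcov : ∀ a b, cov[fun ω => ∑ i, c a i * Z i ω, fun ω => ∑ i, c b i * Z i ω; P]
      = if a = b then 1 else 0 := by
    intro a b
    rw [covariance_fun_sum_fun_sum (fun i => (hG i).memLp_two.const_mul _)
      (fun i => (hG i).memLp_two.const_mul _), ← hc a b]
    refine Finset.sum_congr rfl fun i _ => ?_
    simp_rw [covariance_const_mul_left, covariance_const_mul_right, hcovZ]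
    simp
  have hmarg : ∀ a, P.map (fun ω => ∑ i, c a i * Z i ω) = gaussianReal 0 1 := by
    intro a
    rw [(hlin.eval a).map_eq_gaussianReal, ← covariance_self (hlin.eval a).aemeasurable, hcov a a,
      integral_finsetSum _ fun i _ => (hG i).integrable.const_mul _]
    have : ∀ i, ∫ ω, c a i * Z i ω ∂P = 0 := fun i => by
      rw [integral_const_mul, (hlaw i).integral_eq]
      simp
    simp [this]
  have hind : iIndepFun (fun a ω => ∑ i, c a i * Z i ω) P :=
    hlin.iIndepFun_of_covariance_eq_zero fun a b hab => by rw [hcov a b, if_neg hab]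
  refine ⟨hlin.aemeasurable, ?_⟩
  rw [(iIndepFun_iff_map_fun_eq_pi_map fun a => (hlin.eval a).aemeasurable).1 hind]
  simp_rw [hmarg]

lemma hasLaw_intervalStat_pi {n : ℕ} {x : ℕ → Ω → ℝ}
    (hlaw : ∀ i ∈ Finset.Icc 1 n, HasLaw (x i) (gaussianReal 0 1) P)
    (hindep : iIndepFun (fun i : Finset.Icc 1 n => x i) P) {ι : Type*} [Fintype ι]
    {I : ι → ℕ × ℕ} (hlt : ∀ a, (I a).1 < (I a).2) (hle : ∀ a, (I a).2 ≤ n)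
    (hdisj : ∀ a b, a ≠ b →
      Disjoint (Finset.Ioc (I a).1 (I a).2) (Finset.Ioc (I b).1 (I b).2)) :
    HasLaw (fun ω a => intervalStat (fun i => x i ω) (I a))
      (Measure.pi fun _ => gaussianReal 0 1) P := by
  classical
  have hlen : ∀ a, (0 : ℝ) < ((I a).2 : ℝ) - (I a).1 := fun a =>
    sub_pos.2 (by exact_mod_cast hlt a)
  -- sums over `(j, k]` as sums over `1, …, n`
  have hsum : ∀ a (f : ℕ → ℝ), ∑ i : Finset.Icc 1 n,
      (if (i : ℕ) ∈ Finset.Ioc (I a).1 (I a).2 then f i else 0)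
        = ∑ i ∈ Finset.Ioc (I a).1 (I a).2, f i := by
    intro a f
    rw [Finset.sum_coe_sort (Finset.Icc 1 n)
      fun i => if i ∈ Finset.Ioc (I a).1 (I a).2 then f i else 0, ← Finset.sum_filter]
    congr 1
    ext i
    have := hle a
    simp only [Finset.mem_filter, Finset.mem_Icc, Finset.mem_Ioc]
    omega
  have h := hasLaw_pi_of_orthonormal (fun i : Finset.Icc 1 n => hlaw i i.2) hindep
    (fun a i => if (i : ℕ) ∈ Finset.Ioc (I a).1 (I a).2 then
      1 / √(((I a).2 : ℝ) - (I a).1) else 0) (fun a b => ?_)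
  · convert h using 2 with ω
    funext a
    simp_rw [ite_mul, zero_mul]
    rw [hsum a fun i => 1 / √(((I a).2 : ℝ) - (I a).1) * x i ω, ← Finset.mul_sum, intervalStat]
    ring
  · split_ifs with hab
    · subst hab
      have : ∀ i : Finset.Icc 1 n,
          ((if (i : ℕ) ∈ Finset.Ioc (I a).1 (I a).2 then 1 / √(((I a).2 : ℝ) - (I a).1) else 0) *
          if (i : ℕ) ∈ Finset.Ioc (I a).1 (I a).2 then 1 / √(((I a).2 : ℝ) - (I a).1) else 0)
          = if (i : ℕ) ∈ Finset.Ioc (I a).1 (I a).2 then 1 / (((I a).2 : ℝ) - (I a).1) else 0 := by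
        intro i
        split_ifs
        · rw [← sq, div_pow, Real.sq_sqrt (hlen a).le, one_pow]
        · ring
      rw [Finset.sum_congr rfl fun i _ => this i, hsum a fun _ => 1 / (((I a).2 : ℝ) - (I a).1),
        Finset.sum_const, Nat.card_Ioc, nsmul_eq_mul, Nat.cast_sub (hlt a).le]
      have := (hlen a).ne'
      field_simp
    · refine Finset.sum_eq_zero fun i _ => ?_
      by_cases h1 : (i : ℕ) ∈ Finset.Ioc (I a).1 (I a).2
      · rw [if_neg (Finset.disjoint_left.1 (hdisj a b hab) h1), mul_zero]
      · rw [if_neg h1, zero_mul]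

end Law

/-! ### Deterministic bounds for the structured statistics -/

/-- The weighted Berk-Jones terms of the data `x`, at all levels `l ≤ maxLevel n` and all
`1 ≤ i ≤ N / 2` with `p_(i) < i / N`, are at most `c`; the weight `n / (2 ^ l N)` is multiplied with
the factor `N` in front of the relative entropy. -/
def BernKLBounded (n : ℕ) (x : ℕ → ℝ) (c : ℝ) : Prop :=
  ∀ l ≤ maxLevel n, ∀ i ∈ Finset.Icc 1 ((approxIntervals n l).card / 2),
    orderStat (approxIntervals n l) (fun I => pValue (intervalStat x I)) i
        < (i : ℝ) / (approxIntervals n l).card →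
      (n : ℝ) / 2 ^ l * bernKL ((i : ℝ) / (approxIntervals n l).card)
        (orderStat (approxIntervals n l) (fun I => pValue (intervalStat x I)) i) ≤ c

section Deterministic

variable {n : ℕ} {x : ℕ → ℝ}

lemma orderStat_pValue_mem_Ioo {α : Type*} {s : Finset α} {Y : α → ℝ} {i : ℕ} (hi : 1 ≤ i)
    (his : i ≤ s.card) : orderStat s (fun a => pValue (Y a)) i ∈ Set.Ioo (0 : ℝ) 1 := by
  obtain ⟨a, -, h, -⟩ := exists_orderStat_eq (p := fun a => pValue (Y a)) hi his
  rw [h]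
  exact ⟨pValue_pos _, pValue_lt_one _⟩

lemma structuredBJ_le {c : ℝ} (hc : 0 ≤ c) (h : BernKLBounded n x c) :
    structuredBJ n x ≤ c := by
  refine Real.iSup_le (fun l => ?_) hc
  obtain ⟨l, hl⟩ := l
  have hl' : l ≤ maxLevel n := Nat.lt_succ_iff.1 (Finset.mem_range.1 hl)
  simp only
  rw [berkJones, Real.mul_iSup_of_nonneg (by positivity)]
  refine Real.iSup_le (fun i => ?_) hc
  obtain ⟨i, hi⟩ := i
  simp only
  split_ifs with hlt
  · have hi' := Finset.mem_Icc.1 hi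
    have hN : 0 < (approxIntervals n l).card := by omega
    have hN' : (0 : ℝ) < (approxIntervals n l).card := by exact_mod_cast hN
    refine le_trans (le_of_eq ?_) (h l hl' i hi hlt)
    rw [bernKL, div_div]
    field_simp
  · simpa using hc

/-- The number `N` of intervals cancels from the weighted higher criticism terms. -/
lemma weighted_hc_eq {v N f t : ℝ} (hv : 0 ≤ v) (hN : 0 < N) :
    √(v / N) * (√N * (f - t) / √(t * (1 - t))) = √v * (f - t) / √(t * (1 - t)) := by
  rw [Real.sqrt_div hv]
  have : √N ≠ 0 := (Real.sqrt_pos.2 hN).ne'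
  field_simp

lemma structuredHC_le {c A B : ℝ} (hn : 0 < n) (hA : 0 < A) (hB : 0 ≤ B)
    (hcB : 8 * c + 32 * c ^ 2 * A ≤ B ^ 2) (h : BernKLBounded n x c)
    (hp : ∀ l ≤ maxLevel n, ∀ I ∈ approxIntervals n l,
      1 / ((n : ℝ) / 2 ^ l * A) ≤ pValue (intervalStat x I)) :
    structuredHC n x ≤ B := by
  have hn' : (0 : ℝ) < n := by exact_mod_cast hn
  refine Real.iSup_le (fun l => ?_) hB
  obtain ⟨l, hl⟩ := l
  have hl' : l ≤ maxLevel n := Nat.lt_succ_iff.1 (Finset.mem_range.1 hl)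
  simp only
  rw [higherCriticism, Real.mul_iSup_of_nonneg (by positivity)]
  refine Real.iSup_le (fun i => ?_) hB
  obtain ⟨i, hi⟩ := i
  simp only
  have hi' := Finset.mem_Icc.1 hi
  have hN : 0 < (approxIntervals n l).card := by omega
  have hN' : (0 : ℝ) < (approxIntervals n l).card := by exact_mod_cast hN
  have hv : (0 : ℝ) < n / 2 ^ l := by positivity
  rw [← div_div, weighted_hc_eq hv.le hN']
  set t := orderStat (approxIntervals n l) (fun I => pValue (intervalStat x I)) i with ht
  set f := (i : ℝ) / (approxIntervals n l).card with hf
  obtain ⟨I, hI, htI, -⟩ := exists_orderStat_eq (s := approxIntervals n l)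
    (p := fun I => pValue (intervalStat x I)) hi'.1 (by omega)
  have ht0 : 0 < t := by rw [ht, htI]; exact pValue_pos _
  have ht1 : t < 1 := by rw [ht, htI]; exact pValue_lt_one _
  rcases lt_or_ge t f with hlt | hge
  · have hf2 : f ≤ 1 / 2 := by
      rw [hf, div_le_iff₀ hN']
      have : (2 * i : ℝ) ≤ (approxIntervals n l).card := by exact_mod_cast (by omega)
      linarith
    have hsq := hc_sq_le hv hA ht0 hlt hf2 (h l hl' i hi hlt) (by rw [ht, htI]; exact hp l hl' I hI)
    have hD : 0 < t * (1 - t) := mul_pos ht0 (by linarith)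
    refine le_of_sq_le_sq ?_ hB
    rw [div_pow, mul_pow, Real.sq_sqrt hv.le, Real.sq_sqrt hD.le, mul_div_assoc]
    exact hsq.trans hcB
  · refine le_trans (div_nonpos_of_nonpos_of_nonneg ?_ (Real.sqrt_nonneg _)) hB
    exact mul_nonpos_of_nonneg_of_nonpos (Real.sqrt_nonneg _) (by linarith)

lemma neg_le_structuredHC {A B : ℝ} (hn : 0 < n) (hA : 0 < A) (hB : 0 ≤ B) (hAB : 8 * A ≤ B ^ 2)
    (hp : (approxIntervals n (maxLevel n)).Nonempty →
      orderStat (approxIntervals n (maxLevel n)) (fun I => pValue (intervalStat x I)) 1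
        ≤ 1 - 1 / A) :
    -B ≤ structuredHC n x := by
  have hn' : (0 : ℝ) < n := by exact_mod_cast hn
  set l := maxLevel n with hl
  refine le_trans ?_ (le_ciSup (Set.finite_range _).bddAbove
    (⟨l, Finset.self_mem_range_succ _⟩ : Finset.range (maxLevel n + 1)))
  simp only
  rw [higherCriticism, Real.mul_iSup_of_nonneg (by positivity)]
  rcases Nat.eq_zero_or_pos ((approxIntervals n l).card / 2) with h0 | h0
  -- with at most one interval, the maximum is over the empty set, and `⨆` is `0` by convention
  · have : IsEmpty (Finset.Icc 1 ((approxIntervals n l).card / 2)) := by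
      rw [h0]; exact ⟨fun i => by have := Finset.mem_Icc.1 i.2; omega⟩
    rw [Real.iSup_of_isEmpty]
    linarith
  refine le_trans ?_ (le_ciSup (Set.finite_range _).bddAbove
    (⟨1, Finset.mem_Icc.2 ⟨le_rfl, h0⟩⟩ : Finset.Icc 1 ((approxIntervals n l).card / 2)))
  simp only
  have hN : 0 < (approxIntervals n l).card := by omega
  have hN' : (0 : ℝ) < (approxIntervals n l).card := by exact_mod_cast hN
  have hv : (0 : ℝ) < n / 2 ^ l := by positivity
  rw [← div_div, weighted_hc_eq hv.le hN']
  have hp' := hp (Finset.card_pos.1 hN)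
  obtain ⟨ht0, ht1⟩ := orderStat_pValue_mem_Ioo (s := approxIntervals n l)
    (Y := intervalStat x) le_rfl (by omega)
  set t := orderStat (approxIntervals n l) (fun I => pValue (intervalStat x I)) 1 with ht
  have hv8 : (n : ℝ) / 2 ^ l ≤ 8 := by
    rw [div_le_iff₀ (by positivity)]
    exact_mod_cast le_eight_mul_two_pow_maxLevel hn
  have hD : 0 < t * (1 - t) := mul_pos ht0 (by linarith)
  have h1t : 1 ≤ A * (1 - t) := by
    have : 1 / A ≤ 1 - t := by linarith
    rwa [div_le_iff₀' hA] at this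
  have hkey : √((n : ℝ) / 2 ^ l) * t ≤ B * √(t * (1 - t)) := by
    refine le_of_sq_le_sq ?_ (mul_nonneg hB (Real.sqrt_nonneg _))
    rw [mul_pow, mul_pow, Real.sq_sqrt hv.le, Real.sq_sqrt hD.le]
    calc (n : ℝ) / 2 ^ l * t ^ 2 ≤ 8 * t ^ 2 := by gcongr
      _ ≤ 8 * t := by nlinarith
      _ ≤ 8 * t * (A * (1 - t)) := le_mul_of_one_le_right (by positivity) h1t
      _ = 8 * A * (t * (1 - t)) := by ring
      _ ≤ B ^ 2 * (t * (1 - t)) := by gcongr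
  rw [le_div_iff₀ (Real.sqrt_pos.2 hD)]
  have hi0 : (0 : ℝ) ≤ √((n : ℝ) / 2 ^ l) * (((1 : ℕ) : ℝ) / (approxIntervals n l).card) := by
    positivity
  linarith

/-- A large Berk-Jones term makes one of the likelihood ratios with parameter on the geometric grid
`ρ, ρ ^ 2, …` large, at the cost of a factor `ρ`. The bound `c ≥ 1` excludes very small gaps
`i / N - p_(i)`, so that `O(log n)` grid points suffice. -/
lemma exists_pow_rat_lt_sum_log_tilt {c ρ : ℝ} (hn : 8 ≤ n) (hc : 1 ≤ c) (hρ0 : 0 < ρ) (hρ1 : ρ < 1)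
    (h : ¬ BernKLBounded n x c) :
    ∃ l ≤ maxLevel n, ∃ k : ℕ, 1 / (2 * ((n : ℝ) + 1) ^ 2) ≤ ρ ^ k ∧ ∃ z : ℚ,
      ((approxIntervals n l).card : ℝ) * 2 ^ l / n * (ρ * c) <
        ∑ I ∈ approxIntervals n l,
          Real.log (tilt (gaussianReal 0 1) (ρ ^ (k + 1)) z (intervalStat x I)) := by
  simp only [BernKLBounded, not_forall, not_le] at h
  obtain ⟨l, hl, i, hi, hlt, hKL⟩ := h
  have hi' := Finset.mem_Icc.1 hi
  have hN : 0 < (approxIntervals n l).card := by omega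
  have hN' : (0 : ℝ) < (approxIntervals n l).card := by exact_mod_cast hN
  have hn' : (8 : ℝ) ≤ n := by exact_mod_cast hn
  have hNn : ((approxIntervals n l).card : ℝ) ≤ ((n : ℝ) + 1) ^ 2 := by
    have : (approxIntervals n l).card ≤ (n + 1) ^ 2 := by
      refine (Finset.card_filter_le _ _).trans ?_
      rw [Finset.card_product, Finset.card_range, sq]
    exact_mod_cast this
  obtain ⟨ht0, ht1⟩ := orderStat_pValue_mem_Ioo (s := approxIntervals n l)
    (Y := intervalStat x) hi'.1 (by omega)
  have hrat := fun γ y h0 h1 => exists_rat_lt_sum_log_tilt (s := approxIntervals n l)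
    (intervalStat x) (γ := γ) (y := y) h0 h1 hi'.1 (by omega)
  set t := orderStat (approxIntervals n l) (fun I => pValue (intervalStat x I)) i with ht
  set f := (i : ℝ) / (approxIntervals n l).card with hf
  have hf2 : f ≤ 1 / 2 := by
    rw [hf, div_le_iff₀ hN']
    have : (2 * i : ℝ) ≤ (approxIntervals n l).card := by exact_mod_cast (by omega)
    linarith
  have hflow : 1 / ((n : ℝ) + 1) ^ 2 ≤ f := by
    rw [hf]
    have : (1 : ℝ) ≤ i := by exact_mod_cast hi'.1
    gcongr
  have h1t : 0 < 1 - t := by linarith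
  set g := (f - t) / (1 - t) with hg
  have hg0 : 0 < g := div_pos (by linarith) h1t
  have hg1 : g < 1 := (div_lt_one h1t).2 (by linarith)
  have hgap : f - t ≤ g := by
    rw [hg, le_div_iff₀ h1t]
    nlinarith
  -- if `g` is very small then the relative entropy is below `1 / (n + 1) ^ 2`
  have hglow : 1 / (2 * ((n : ℝ) + 1) ^ 2) ≤ g := by
    by_contra hcon
    push Not at hcon
    have e : 1 / (2 * ((n : ℝ) + 1) ^ 2) = 1 / ((n : ℝ) + 1) ^ 2 / 2 := by field_simp
    have hft : f ≤ 2 * t := by linarith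
    have h1 : bernKL f t ≤ 2 * (f - t) := by
      refine (bernKL_upper ht0 hlt (by linarith)).trans ?_
      rw [div_le_iff₀ ht0]
      nlinarith
    have h2 : bernKL f t ≤ 1 / ((n : ℝ) + 1) ^ 2 := by linarith
    have h3 : (n : ℝ) / 2 ^ l * bernKL f t ≤ n * (1 / ((n : ℝ) + 1) ^ 2) := by
      refine mul_le_mul (div_le_self (by linarith) (one_le_pow₀ one_le_two)) h2
        (bernKL_nonneg ht0 hlt (by linarith)) (by linarith)
    have h4 : n * (1 / ((n : ℝ) + 1) ^ 2) ≤ 1 := by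
      rw [mul_one_div, div_le_one (by positivity)]
      nlinarith
    linarith
  -- the grid point just below the optimal parameter `g`
  obtain ⟨k, hk1, hk2⟩ := exists_nat_pow_near_of_lt_one hg0 hg1.le hρ0 hρ1
  refine ⟨l, hl, k, hglow.trans hk2,
    hrat _ _ (by positivity) (pow_lt_one₀ hρ0.le hρ1 (by omega)) ?_⟩
  have hcle : ρ ≤ ρ ^ (k + 1) / g := by
    rw [le_div_iff₀ hg0, pow_succ']
    gcongr
  have hrate := mul_bernKL_le_tiltRate (c := ρ ^ (k + 1) / g) ht0 hlt (by linarith)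
    (by positivity) ((div_le_one hg0).2 hk1.le)
  rw [← hg, div_mul_cancel₀ _ hg0.ne'] at hrate
  have hKL0 := bernKL_nonneg ht0 hlt (by linarith)
  have h5 : ρ * bernKL f t ≤ tiltRate (ρ ^ (k + 1)) f t :=
    (mul_le_mul_of_nonneg_right hcle hKL0).trans hrate
  have hv : (0 : ℝ) < n / 2 ^ l := by positivity
  calc ((approxIntervals n l).card : ℝ) * 2 ^ l / n * (ρ * c)
      = (approxIntervals n l).card * (ρ * (c / (n / 2 ^ l))) := by field_simp
    _ < (approxIntervals n l).card * (ρ * bernKL f t) := by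
        gcongr
        rwa [div_lt_iff₀' hv]
    _ ≤ _ := by gcongr

end Deterministic

/-! ### Probability bounds and asymptotics -/

section Probability

variable {n : ℕ} {Ω : Type*} [MeasurableSpace Ω] {P : Measure Ω} [IsProbabilityMeasure P]
  {x : ℕ → Ω → ℝ}

lemma hasLaw_intervalStat (hlaw : ∀ i ∈ Finset.Icc 1 n, HasLaw (x i) (gaussianReal 0 1) P)
    (hindep : iIndepFun (fun i : Finset.Icc 1 n => x i) P) {l : ℕ} {I : ℕ × ℕ}
    (hI : I ∈ approxIntervals n l) :
    HasLaw (fun ω => intervalStat (fun i => x i ω) I) (gaussianReal 0 1) P :=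
  (measurePreserving_eval (fun _ : Unit => gaussianReal 0 1) ()).hasLaw.comp
    (hasLaw_intervalStat_pi hlaw hindep (I := fun _ : Unit => I)
      (fun _ => lt_of_mem_approxIntervals hI) (fun _ => (mem_approxIntervals.1 hI).2.1)
      (fun a b hab => absurd (Subsingleton.elim a b) hab))

lemma meas_exists_rat_intervalStat_le
    (hlaw : ∀ i ∈ Finset.Icc 1 n, HasLaw (x i) (gaussianReal 0 1) P)
    (hindep : iIndepFun (fun i : Finset.Icc 1 n => x i) P) (hn : 8 ≤ n) {l : ℕ}
    (hl : l ≤ maxLevel n) {γ q w : ℝ} (h0 : 0 ≤ γ) (h1 : γ < 1) (hq0 : 0 < q) (hq1 : q < 1)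
    (hw : 0 ≤ w) :
    P {ω | ∃ z : ℚ, ((approxIntervals n l).card : ℝ) * 2 ^ l / n * w <
        ∑ I ∈ approxIntervals n l, Real.log (tilt (gaussianReal 0 1) γ z
          (intervalStat (fun i => x i ω) I))}
      ≤ ENNReal.ofReal (1 / (1 - q) * Real.exp (-(q * w * (3 / 4)))) := by
  rcases (approxIntervals n l).eq_empty_or_nonempty with h | ⟨I₀, hI₀⟩
  · simp [h]
  have hΛ : (intervalLabels n l).Nonempty := ⟨_, intervalLabel_mem hI₀⟩
  refine (meas_exists_rat_sum_log_tilt_gt_le (Y := fun I ω => intervalStat (fun i => x i ω) I)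
    h0 h1 pValue_pos (fun _ => intervalLabel_mem) hΛ (fun g _ => ?_) hq0 hq1 _).trans ?_
  · refine hasLaw_intervalStat_pi hlaw hindep
      (I := fun a : {I // I ∈ (approxIntervals n l).filter fun I => intervalLabel n l I = g} => a)
      (fun a => lt_of_mem_approxIntervals (Finset.mem_filter.1 a.2).1)
      (fun a => (mem_approxIntervals.1 (Finset.mem_filter.1 a.2).1).2.1) fun a b hab => ?_
    obtain ⟨ha, ha'⟩ := Finset.mem_filter.1 a.2
    obtain ⟨hb, hb'⟩ := Finset.mem_filter.1 b.2
    exact disjoint_of_intervalLabel_eq ha hb (ha'.trans hb'.symm) fun h => hab (Subtype.ext h)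
  · have hcount : (3 * n * (intervalLabels n l).card : ℝ)
        ≤ 4 * 2 ^ l * (approxIntervals n l).card := by
      exact_mod_cast card_intervalLabels_mul_le (four_mul_two_pow_le hn hl)
        (gridStep_pos_of_mem hI₀)
    have hG : (0 : ℝ) < (intervalLabels n l).card := by exact_mod_cast hΛ.card_pos
    have hn' : (0 : ℝ) < n := by exact_mod_cast (by omega : 0 < n)
    have h1q : 0 < 1 - q := by linarith
    refine ENNReal.ofReal_le_ofReal (mul_le_mul_of_nonneg_left (Real.exp_le_exp.2 ?_)
      (by positivity))
    rw [neg_le_neg_iff, le_div_iff₀ hG]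
    have : 3 / 4 * ((intervalLabels n l).card : ℝ)
        ≤ (approxIntervals n l).card * 2 ^ l / n := by
      rw [le_div_iff₀ hn']
      linarith
    calc q * w * (3 / 4) * (intervalLabels n l).card
        = q * w * (3 / 4 * (intervalLabels n l).card) := by ring
      _ ≤ q * w * ((approxIntervals n l).card * 2 ^ l / n) := by gcongr
      _ = _ := by ring

lemma maxLevel_add_one_le (hn : 8 ≤ n) : ((maxLevel n + 1 : ℕ) : ℝ) ≤ 3 * Real.log n := by
  have hn' : (8 : ℝ) ≤ n := by exact_mod_cast hn
  have h : (4 * 2 ^ maxLevel n : ℝ) ≤ n := by exact_mod_cast four_mul_two_pow_le hn le_rfl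
  have h1 : (maxLevel n : ℝ) * Real.log 2 ≤ Real.log n := by
    rw [← Real.log_pow]
    exact Real.log_le_log (by positivity) (by linarith [pow_pos (two_pos (α := ℝ)) (maxLevel n)])
  have h2 : 1 ≤ Real.log n := by
    rw [Real.le_log_iff_exp_le (by linarith)]
    linarith [Real.exp_one_lt_d9]
  push_cast
  nlinarith [Real.log_two_gt_d9, (Nat.cast_nonneg (maxLevel n) : (0 : ℝ) ≤ maxLevel n)]

/-- The union bound over levels and grid points. -/
lemma meas_not_bernKLBounded_le
    (hlaw : ∀ i ∈ Finset.Icc 1 n, HasLaw (x i) (gaussianReal 0 1) P)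
    (hindep : iIndepFun (fun i : Finset.Icc 1 n => x i) P) (hn : 8 ≤ n) {c q ρ : ℝ} (hc : 1 ≤ c)
    (hρ0 : 0 < ρ) (hρ1 : ρ < 1) (hq0 : 0 < q) (hq1 : q < 1) :
    P {ω | ¬ BernKLBounded n (fun i => x i ω) c} ≤
      ENNReal.ofReal (3 * Real.log n * ((3 / Real.log (1 / ρ) + 1) * Real.log n) *
        (1 / (1 - q) * Real.exp (-(q * (ρ * c) * (3 / 4))))) := by
  have hn' : (8 : ℝ) ≤ n := by exact_mod_cast hn
  have hlog : 1 ≤ Real.log n := by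
    rw [Real.le_log_iff_exp_le (by linarith)]
    linarith [Real.exp_one_lt_d9]
  have hr : 0 < Real.log (1 / ρ) := Real.log_pos (by rw [lt_div_iff₀ hρ0]; linarith)
  set b := 1 / (1 - q) * Real.exp (-(q * (ρ * c) * (3 / 4))) with hb
  have h1q : 0 < 1 - q := by linarith
  have hb0 : 0 ≤ b := by positivity
  set K := ⌊3 * Real.log n / Real.log (1 / ρ)⌋₊ + 1 with hK
  have hKle : (K : ℝ) ≤ (3 / Real.log (1 / ρ) + 1) * Real.log n := by
    have := Nat.floor_le (a := 3 * Real.log n / Real.log (1 / ρ)) (by positivity)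
    rw [hK]
    push_cast
    calc (⌊3 * Real.log n / Real.log (1 / ρ)⌋₊ : ℝ) + 1
        ≤ 3 * Real.log n / Real.log (1 / ρ) + Real.log n := by linarith
      _ = _ := by ring
  have hsub : {ω | ¬ BernKLBounded n (fun i => x i ω) c} ⊆
      ⋃ l ∈ Finset.range (maxLevel n + 1), ⋃ k ∈ Finset.range K,
        {ω | ∃ z : ℚ, ((approxIntervals n l).card : ℝ) * 2 ^ l / n * (ρ * c) <
        ∑ I ∈ approxIntervals n l, Real.log (tilt (gaussianReal 0 1) (ρ ^ (k + 1)) z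
          (intervalStat (fun i => x i ω) I))} := by
    intro ω hω
    obtain ⟨l, hl, k, hk, hz⟩ := exists_pow_rat_lt_sum_log_tilt hn hc hρ0 hρ1 hω
    simp only [Set.mem_iUnion, Finset.mem_range]
    refine ⟨l, Nat.lt_succ_iff.2 hl, k, ?_, hz⟩
    rw [hK, Nat.lt_succ_iff]
    refine Nat.le_floor ((le_div_iff₀ hr).2 ?_)
    have h1 : (1 / ρ) ^ k ≤ (n : ℝ) ^ 3 := by
      rw [one_div, inv_pow]
      refine (inv_le_of_inv_le₀ (by positivity) (le_trans ?_ hk))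
      rw [← one_div]
      refine one_div_le_one_div_of_le (by positivity) ?_
      nlinarith [sq_nonneg (n : ℝ)]
    have h2 := Real.log_le_log (by positivity) h1
    rw [Real.log_pow, Real.log_pow] at h2
    exact_mod_cast h2
  refine (measure_mono hsub).trans ?_
  calc _ ≤ ∑ l ∈ Finset.range (maxLevel n + 1), ∑ k ∈ Finset.range K, ENNReal.ofReal b := by
        refine (measure_biUnion_finset_le _ _).trans (Finset.sum_le_sum fun l hl => ?_)
        refine (measure_biUnion_finset_le _ _).trans (Finset.sum_le_sum fun k _ => ?_)
        exact meas_exists_rat_intervalStat_le hlaw hindep hn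
          (Nat.lt_succ_iff.1 (Finset.mem_range.1 hl)) (by positivity)
          (pow_lt_one₀ hρ0.le hρ1 (by omega)) hq0 hq1 (by positivity)
    _ = ENNReal.ofReal ((maxLevel n + 1 : ℕ) * K * b) := by
        rw [Finset.sum_const, Finset.sum_const, Finset.card_range, Finset.card_range, smul_smul,
          nsmul_eq_mul, ← ENNReal.ofReal_natCast, ← ENNReal.ofReal_mul (Nat.cast_nonneg _)]
        push_cast
        rfl
    _ ≤ _ := by
        have := maxLevel_add_one_le hn
        refine ENNReal.ofReal_le_ofReal ?_
        gcongr

/-- The smallest p-value of level `l` is at least of the order `2 ^ l / (n A)`, at all levels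
simultaneously. -/
lemma meas_exists_pValue_lt_le
    (hlaw : ∀ i ∈ Finset.Icc 1 n, HasLaw (x i) (gaussianReal 0 1) P)
    (hindep : iIndepFun (fun i : Finset.Icc 1 n => x i) P) (hn : 8 ≤ n) {A : ℝ} (hA : 1 ≤ A) :
    P {ω | ∃ l ≤ maxLevel n, ∃ I ∈ approxIntervals n l,
        pValue (intervalStat (fun i => x i ω) I) < 1 / ((n : ℝ) / 2 ^ l * A)} ≤
      ENNReal.ofReal (3 * Real.log n * (144 * Real.logb 2 (2 * n) / A)) := by
  have hn' : (8 : ℝ) ≤ n := by exact_mod_cast hn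
  have hL : 0 ≤ Real.logb 2 (2 * n) := Real.logb_nonneg one_lt_two (by linarith)
  have hsub : {ω | ∃ l ≤ maxLevel n, ∃ I ∈ approxIntervals n l,
        pValue (intervalStat (fun i => x i ω) I) < 1 / ((n : ℝ) / 2 ^ l * A)} ⊆
      ⋃ l ∈ Finset.range (maxLevel n + 1), ⋃ I ∈ approxIntervals n l,
        {ω | pValue (intervalStat (fun i => x i ω) I) ≤ 1 / ((n : ℝ) / 2 ^ l * A)} := by
    rintro ω ⟨l, hl, I, hI, h⟩
    simp only [Set.mem_iUnion, Finset.mem_range]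
    exact ⟨l, Nat.lt_succ_iff.2 hl, I, hI, h.le⟩
  refine (measure_mono hsub).trans ?_
  calc _ ≤ ∑ l ∈ Finset.range (maxLevel n + 1),
        ENNReal.ofReal (144 * Real.logb 2 (2 * n) / A) := by
        refine (measure_biUnion_finset_le _ _).trans (Finset.sum_le_sum fun l hl => ?_)
        have hl' := Nat.lt_succ_iff.1 (Finset.mem_range.1 hl)
        have h4 : (4 * 2 ^ l : ℝ) ≤ n := by exact_mod_cast four_mul_two_pow_le hn hl'
        have hv : (4 : ℝ) ≤ n / 2 ^ l := by rwa [le_div_iff₀ (by positivity)]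
        have hvA : 1 < (n : ℝ) / 2 ^ l * A := by nlinarith
        refine (measure_biUnion_finset_le _ _).trans ?_
        calc _ ≤ ∑ I ∈ approxIntervals n l, ENNReal.ofReal (1 / ((n : ℝ) / 2 ^ l * A)) := by
              refine Finset.sum_le_sum fun I hI => le_of_eq ?_
              exact meas_pValue_le (hasLaw_intervalStat hlaw hindep hI) (by positivity)
                ((div_lt_one (by linarith)).2 hvA)
          _ = ENNReal.ofReal ((approxIntervals n l).card * (1 / ((n : ℝ) / 2 ^ l * A))) := by
              rw [Finset.sum_const, nsmul_eq_mul, ← ENNReal.ofReal_natCast,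
                ← ENNReal.ofReal_mul (Nat.cast_nonneg _)]
          _ ≤ _ := by
              refine ENNReal.ofReal_le_ofReal ?_
              have hA0 : 0 < A := by linarith
              rw [mul_one_div, div_le_div_iff₀ (by linarith) hA0]
              have := card_approxIntervals_le hn hl'
              calc _ ≤ 144 * (n / 2 ^ l) * Real.logb 2 (2 * n) * A := by gcongr
                _ = _ := by ring
    _ = ENNReal.ofReal ((maxLevel n + 1 : ℕ) * (144 * Real.logb 2 (2 * n) / A)) := by
        rw [Finset.sum_const, Finset.card_range, nsmul_eq_mul, ← ENNReal.ofReal_natCast,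
          ← ENNReal.ofReal_mul (Nat.cast_nonneg _)]
    _ ≤ _ := by
        have := maxLevel_add_one_le hn
        refine ENNReal.ofReal_le_ofReal ?_
        gcongr

lemma meas_lt_orderStat_one_le
    (hlaw : ∀ i ∈ Finset.Icc 1 n, HasLaw (x i) (gaussianReal 0 1) P)
    (hindep : iIndepFun (fun i : Finset.Icc 1 n => x i) P) (l : ℕ) {A : ℝ} (hA : 1 < A) :
    P {ω | (approxIntervals n l).Nonempty ∧ 1 - 1 / A <
        orderStat (approxIntervals n l) (fun I => pValue (intervalStat (fun i => x i ω) I)) 1} ≤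
      ENNReal.ofReal (1 / A) := by
  by_cases h : (approxIntervals n l).Nonempty
  · obtain ⟨I, hI⟩ := h
    have h1 : 1 / A < 1 := (div_lt_one (by linarith)).2 hA
    have h0 : 0 < 1 / A := by positivity
    have := meas_le_pValue (hasLaw_intervalStat hlaw hindep hI) (τ := 1 - 1 / A) (by linarith)
      (by linarith)
    rw [sub_sub_cancel] at this
    rw [← this]
    refine measure_mono fun ω hω => ?_
    exact hω.2.le.trans
      (orderStat_one_le (p := fun I => pValue (intervalStat (fun i => x i ω) I)) hI)
  · simp [h]

end Probability

section Asymptotics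

lemma tendsto_log_natCast : Tendsto (fun n : ℕ => Real.log n) atTop atTop :=
  Real.tendsto_log_atTop.comp tendsto_natCast_atTop_atTop

lemma tendsto_kl_bound {C q r : ℝ} (hqr : 2 < q * (r * 3) * (3 / 4)) :
    Tendsto (fun n : ℕ => ENNReal.ofReal (3 * Real.log n * (C * Real.log n) *
      (1 / (1 - q) * Real.exp (-(q * (r * (3 * Real.log (Real.log n))) * (3 / 4)))))) atTop
      (𝓝 0) := by
  rw [← ENNReal.ofReal_zero]
  refine (ENNReal.continuous_ofReal.tendsto 0).comp ?_
  have h : Tendsto (fun y : ℝ => 3 * C * (1 / (1 - q)) * y ^ (-(q * (r * 3) * (3 / 4) - 2))) atTop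
      (𝓝 0) := by
    simpa using (tendsto_rpow_neg_atTop (sub_pos.2 hqr)).const_mul (3 * C * (1 / (1 - q)))
  refine (h.comp tendsto_log_natCast).congr' ?_
  filter_upwards [tendsto_log_natCast.eventually_gt_atTop 0] with n hn
  simp only [Function.comp]
  have e : Real.exp (-(q * (r * (3 * Real.log (Real.log n))) * (3 / 4)))
      = Real.log n ^ (-(q * (r * 3) * (3 / 4))) := by
    rw [Real.rpow_def_of_pos hn]; congr 1; ring
  rw [e, show -(q * (r * 3) * (3 / 4) - 2) = 2 + -(q * (r * 3) * (3 / 4)) by ring,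
    Real.rpow_add hn, Real.rpow_two]
  ring

lemma tendsto_pValue_bound :
    Tendsto (fun n : ℕ => ENNReal.ofReal (3 * Real.log n *
      (144 * Real.logb 2 (2 * n) / Real.log n ^ 3))) atTop (𝓝 0) := by
  rw [← ENNReal.ofReal_zero]
  refine (ENNReal.continuous_ofReal.tendsto 0).comp ?_
  have h : Tendsto (fun y : ℝ => 3 * 144 * (1 / Real.log 2) * (Real.log 2 * (y⁻¹ * y⁻¹) + y⁻¹))
      atTop (𝓝 0) := by
    have := ((tendsto_inv_atTop_zero (𝕜 := ℝ)).mul (tendsto_inv_atTop_zero (𝕜 := ℝ))).const_mul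
      (Real.log 2) |>.add (tendsto_inv_atTop_zero (𝕜 := ℝ))
    simpa using this.const_mul (3 * 144 * (1 / Real.log 2))
  refine (h.comp tendsto_log_natCast).congr' ?_
  filter_upwards [tendsto_log_natCast.eventually_gt_atTop 0, eventually_gt_atTop 0] with n hn hn0
  have hn0' : (n : ℝ) ≠ 0 := by exact_mod_cast hn0.ne'
  have h2 : Real.log 2 ≠ 0 := (Real.log_pos one_lt_two).ne'
  simp only [Function.comp, Real.logb]
  rw [Real.log_mul two_ne_zero hn0']
  field_simp

lemma tendsto_one_div_log_cube :
    Tendsto (fun n : ℕ => ENNReal.ofReal (1 / Real.log n ^ 3)) atTop (𝓝 0) := by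
  rw [← ENNReal.ofReal_zero]
  refine (ENNReal.continuous_ofReal.tendsto 0).comp ?_
  simp_rw [one_div]
  exact ((tendsto_pow_atTop three_ne_zero).comp tendsto_log_natCast).inv_tendsto_atTop

lemma eventually_loglog_poly_le : ∀ᶠ n : ℕ in atTop,
    8 * (3 * Real.log (Real.log n)) + 32 * (3 * Real.log (Real.log n)) ^ 2 * Real.log n ^ 3
      ≤ (Real.log n ^ 2) ^ 2 := by
  have h1 := (Real.isLittleO_pow_log_id_atTop (n := 2)).bound (by norm_num : (0 : ℝ) < 1 / 312)
  filter_upwards [tendsto_log_natCast.eventually h1, tendsto_log_natCast.eventually_ge_atTop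
    (Real.exp 1)] with n hn hn2
  set y := Real.log n
  have hy1 : 1 ≤ y := by linarith [Real.exp_one_gt_d9]
  have hL : 1 ≤ Real.log y := (Real.le_log_iff_exp_le (by linarith)).2 hn2
  simp only [norm_pow, Real.norm_eq_abs, id, sq_abs, abs_of_nonneg (zero_le_one.trans hy1)] at hn
  have hy3 : 1 ≤ y ^ 3 := one_le_pow₀ hy1
  set L := Real.log y
  calc 8 * (3 * L) + 32 * (3 * L) ^ 2 * y ^ 3 ≤ 312 * L ^ 2 * y ^ 3 := by
        nlinarith [mul_le_mul (show L ≤ L ^ 2 by nlinarith) hy3 zero_le_one (by positivity)]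
    _ ≤ 312 * (1 / 312 * y) * y ^ 3 := by gcongr
    _ = (y ^ 2) ^ 2 := by ring

/-- The weighted Berk-Jones terms are at most `3 log log n` with probability tending to one. -/
lemma tendsto_not_bernKLBounded {Ω : ℕ → Type*} [∀ n, MeasurableSpace (Ω n)]
    (P : ∀ n, Measure (Ω n)) [∀ n, IsProbabilityMeasure (P n)] (X : ∀ n, ℕ → Ω n → ℝ)
    (hlaw : ∀ n, ∀ i ∈ Finset.Icc 1 n, HasLaw (X n i) (gaussianReal 0 1) (P n))
    (hindep : ∀ n, iIndepFun (fun i : Finset.Icc 1 n => X n i) (P n)) :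
    Tendsto (fun n => P n {ω | ¬ BernKLBounded n (fun i => X n i ω)
      (3 * Real.log (Real.log n))}) atTop (𝓝 0) := by
  refine tendsto_of_tendsto_of_tendsto_of_le_of_le' tendsto_const_nhds
    (tendsto_kl_bound (C := 3 / Real.log (1 / (24 / 25)) + 1) (q := 24 / 25) (r := 24 / 25)
      -- `(24 / 25) ^ 2 * 3 * (3 / 4) > 2`
      (by norm_num)) (Eventually.of_forall fun _ => zero_le) ?_
  filter_upwards [eventually_ge_atTop 8, tendsto_log_natCast.eventually_ge_atTop (Real.exp 1)]
    with n hn hn2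
  have hL : 1 ≤ Real.log (Real.log n) :=
    (Real.le_log_iff_exp_le ((Real.exp_pos 1).trans_le hn2)).2 hn2
  exact meas_not_bernKLBounded_le (hlaw n) (hindep n) hn (by linarith) (by norm_num) (by norm_num)
    (by norm_num) (by norm_num)

end Asymptotics

end BlockStructure

theorem theorem2 {Ω : ℕ → Type*} [∀ n, MeasurableSpace (Ω n)] (P : ∀ n, Measure (Ω n))
    [∀ n, IsProbabilityMeasure (P n)] (X : ∀ n, ℕ → Ω n → ℝ)
    (hlaw : ∀ n, ∀ i ∈ Finset.Icc 1 n, HasLaw (X n i) (gaussianReal 0 1) (P n))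
    (hindep : ∀ n, iIndepFun (fun i : Finset.Icc 1 n => X n i) (P n)) :
    BlockStructure.AsympLEInProb P
        (fun n ω => BlockStructure.structuredBJ n (fun i => X n i ω) / Real.log (Real.log n)) 3 ∧
      BlockStructure.IsBigOInProb P
        (fun n ω => BlockStructure.structuredHC n (fun i => X n i ω))
        (fun n => Real.log n ^ 2) := by
  have hKL := BlockStructure.tendsto_not_bernKLBounded P X hlaw hindep
  refine ⟨fun ε hε => ?_, fun ε hε => ⟨1, ?_⟩⟩
  · refine tendsto_of_tendsto_of_tendsto_of_le_of_le' tendsto_const_nhds hKL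
      (Eventually.of_forall fun _ => zero_le) ?_
    filter_upwards [BlockStructure.tendsto_log_natCast.eventually_ge_atTop (Real.exp 1)] with n hn
    have hL : 1 ≤ Real.log (Real.log n) :=
      (Real.le_log_iff_exp_le ((Real.exp_pos 1).trans_le hn)).2 hn
    refine measure_mono fun ω hω hbd => ?_
    have h1 := BlockStructure.structuredBJ_le (by linarith) hbd
    have h2 : 3 + ε < BlockStructure.structuredBJ n (fun i => X n i ω) / Real.log (Real.log n) := hω
    rw [lt_div_iff₀ (by linarith)] at h2
    nlinarith
  · have hsum := (hKL.add BlockStructure.tendsto_pValue_bound).add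
      BlockStructure.tendsto_one_div_log_cube
    rw [add_zero, add_zero] at hsum
    filter_upwards [hsum.eventually (ge_mem_nhds (ENNReal.ofReal_pos.2 hε)),
      BlockStructure.eventually_loglog_poly_le,
      BlockStructure.tendsto_log_natCast.eventually_ge_atTop 8, eventually_ge_atTop 8]
      with n hn hpoly hlog hn8
    refine le_trans ?_ hn
    have hA : 1 < Real.log n ^ 3 := one_lt_pow₀ (by linarith) three_ne_zero
    refine le_trans ?_ (add_le_add (add_le_add le_rfl
      (BlockStructure.meas_exists_pValue_lt_le (hlaw n) (hindep n) hn8 hA.le))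
      (BlockStructure.meas_lt_orderStat_one_le (hlaw n) (hindep n)
        (BlockStructure.maxLevel n) hA))
    refine le_trans (measure_mono fun ω hω => ?_)
      ((measure_union_le _ _).trans (add_le_add (measure_union_le _ _) le_rfl))
    by_contra hcon
    simp only [Set.mem_union, Set.mem_ofPred_eq, not_or, not_exists, not_and, not_lt, not_not]
      at hcon
    obtain ⟨⟨hbd, hlow⟩, htop⟩ := hcon
    have hB : (0 : ℝ) < Real.log n ^ 2 := by positivity
    have hup := BlockStructure.structuredHC_le (by omega) (by linarith) hB.le hpoly hbd hlow
    have hdown := BlockStructure.neg_le_structuredHC (by omega)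
      (by linarith : 0 < Real.log n ^ 3) hB.le (by nlinarith) htop
    have habs : (1 : ℝ) < |BlockStructure.structuredHC n (fun i => X n i ω) / Real.log n ^ 2| := hω
    rw [abs_div, abs_of_pos hB, lt_div_iff₀ hB, one_mul] at habs
    exact absurd (abs_le.2 ⟨hdown, hup⟩) (not_le.2 habs)
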